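/- **Setting.** Let $z$ take values in a measurable space $\mathcal Z$ with law $\nu$, let $\Theta$ be a model space (a measurable space), $l:\Theta\times\mathcal Z\to\mathbb R$ a jointly measurable loss with $l(\theta,z)$ integrable for every $\theta$, and $L(\theta):=\mathbb E[l(\theta,z)]$, with $L$ bounded below; $\min_\Theta L$ denotes the optimal value (the infimum, if it is not attained). A base learner is a family of measurable maps $\mathcal A=\mathcal A_k:\mathcal Z^k\times\mathbf\Omega\to\Theta$, $k\ge 0$, where the algorithmic randomness $\omega\in\mathbf\Omega$ has a fixed law and is independent of the data. For i.i.d. $z_1,\dots,z_k\sim\nu$ put $$\mathcal E_{k,\delta}:=\mathbb P\big(L(\mathcal A(z_1,\dots,z_k;\omega))>\min_{\Theta}L+\delta\big),\qquad T_k(t):=\mathbb P\Big(\sup_{\theta\in\Theta}\Big|\frac1k\sum_{i=1}^k l(\theta,z_i)-L(\theta)\Big|>t\Big).$$ **Procedure** (data $z_1,\dots,z_n$ i.i.d. $\sim\nu$; subsample sizes $k_1,k_2\ge1$; ensemble sizes $B_1,B_2\ge1$). *ROVE* (no splitting, $k_1,k_2<n$) uses all of $z_1,\dots,z_n$ in both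 phases. *ROVEs* (splitting, $k_1,k_2\le n/2$) uses $z_1,\dots,z_{\lfloor n/2\rfloor}$ in Phase I and in the choice of $\epsilon$, and $z_{\lfloor n/2\rfloor+1},\dots,z_n$ in Phase II. Phase I: draw $B_1$ independent uniform subsamples of size $k_1$ without replacement from the Phase I data, run $\mathcal A$ on each with independent algorithmic randomness, and let $\mathcal S$ be the set of the models obtained. Then choose $\epsilon\ge0$ as a measurable function of the Phase I data, possibly also of the Phase I randomness and of additional independent randomness. Phase II: draw $B_2$ independent uniform subsamples $(z_1^b,\dots,z_{k_2}^b)$ of size $k_2$ without replacement from the Phase II data, independently of everything else, put $$\widehat\Theta^{\epsilon,b}:=\Big\{\theta\in\mathcal S:\ \frac1{k_2}\sum_{i=1}^{k_2} l(\theta,z_i^b)\le\min_{\theta'\in\mathcal S}\frac1{k_2}\sum_{i=1}^{k_2} l(\theta',z_i^b)+\epsilon\Big\},$$ and output any $\hat\theta_n\in\arg\max_{\theta\in\mathcal S}\sum_{b=1}^{B_2}\mathbf 1(\theta\in\widehat\Theta^{\epsilon,b})$, ties being broken arbitrarily. **Theorem 2.** *Part 1 (ROVEs).* There are universal constants $C_1,\dots,C_7>0$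 such that the following holds in every setting as above, for all such $n,k_1,k_2,B_1,B_2$ and every $\delta>0$. If $\mathbb P(\epsilon\in[\underline\epsilon,\overline\epsilon])=1$ for some $0<\underline\epsilon\le\overline\epsilon<\delta$ and $T_{k_2}\big((\delta-\overline\epsilon)/2\big)+T_{k_2}\big(\underline\epsilon/2\big)<1/5$, then $$\begin{aligned}\mathbb P\big(L(\hat\theta_n)>\min_\Theta L+2\delta\big)\le{}& B_1\Big[3\min\Big\{e^{-2/5},\,C_1T_{k_2}\Big(\frac{\min\{\underline\epsilon,\delta-\overline\epsilon\}}2\Big)\Big\}^{\frac n{2C_2k_2}}+e^{-B_2/C_3}\Big]\\&+\min\Big\{e^{-(1-\mathcal E_{k_1,\delta})/C_4},\,C_5\,\mathcal E_{k_1,\delta}\Big\}^{\frac n{2C_6k_1}}+e^{-B_1(1-\mathcal E_{k_1,\delta})/C_7}.\end{aligned}$$ *Part 2 (ROVE).* Let $\Theta$ be finite and assume $\lim_{k\to\infty}T_k(t)=0$ for every $t>0$. Let $k_1,k_2,B_1,B_2$ and the rule for $\epsilon$ depend on $n$. Fix $\delta>0$. If $\limsup_{k\to\infty}\mathcal E_{k,\delta}<1$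 and, as $n\to\infty$, $\mathbb P(\epsilon>\delta/2)\to0$, $k_1,k_2\to\infty$, $n/k_1,n/k_2\to\infty$ and $B_1,B_2\to\infty$, then $$\lim_{n\to\infty}\mathbb P\big(L(\hat\theta_n)>\min_\Theta L+2\delta\big)=0.$$ -/

import Mathlib

open MeasureTheory Filter Topology
open scoped NNReal

noncomputable section

namespace ROVE

/-! ### The stochastic optimization problem `min_θ L(θ) = E[l(θ, z)]`, with `z ∼ ν` -/

section Problem

variable {Z Θ R : Type*} [MeasurableSpace Z] [MeasurableSpace R]

/-- The population objective `L(θ) = E[l(θ, z)]`. -/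
def risk (ν : Measure Z) (l : Θ → Z → ℝ) (θ : Θ) : ℝ := ∫ z, l θ z ∂ν

/-- The optimal value of `L` over `Θ`. -/
def optRisk (ν : Measure Z) (l : Θ → Z → ℝ) : ℝ := ⨅ θ, risk ν l θ

/-- The empirical objective `(1/k) ∑ᵢ l(θ, xᵢ)` of a sample of size `k`. -/
def empRisk (l : Θ → Z → ℝ) {k : ℕ} (x : Fin k → Z) (θ : Θ) : ℝ :=
  (1 / (k : ℝ)) * ∑ i, l θ (x i)

/-- `T_k(t)`: the probability that the maximum deviation
`sup_θ |(1/k) ∑ᵢ l(θ, zᵢ) - L(θ)|` over `k` i.i.d. observations exceeds `t`.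
The supremum is taken in the extended reals, so that it may be infinite. -/
def devTail (ν : Measure Z) (l : Θ → Z → ℝ) (k : ℕ) (t : ℝ) : ℝ :=
  (Measure.pi fun _ : Fin k => ν).real
    {x | (t : EReal) < ⨆ θ, ((|empRisk l x θ - risk ν l θ| : ℝ) : EReal)}

/-- The excess risk tail of a base learner: the probability, over `k` i.i.d. observations and
the independent algorithmic randomness `ω ∼ ρ`, that `L(A(z₁, …, z_k; ω)) > min L + δ`. -/
def excessTail (ν : Measure Z) (ρ : Measure R) (l : Θ → Z → ℝ)
    (A : (k : ℕ) → (Fin k → Z) → R → Θ) (k : ℕ) (δ : ℝ) : ℝ :=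
  ((Measure.pi fun _ : Fin k => ν).prod ρ).real
    {p | optRisk ν l + δ < risk ν l (A k p.1 p.2)}

end Problem

/-! ### The randomness of the two phases

A subsample of size `k` drawn without replacement from `m` data points is an injection
`Fin k ↪ Fin m`, drawn uniformly. -/

instance instMeasurableSpaceSubsample (k m : ℕ) : MeasurableSpace (Fin k ↪ Fin m) := ⊤

instance instDiscreteSubsample (k m : ℕ) : DiscreteMeasurableSpace (Fin k ↪ Fin m) :=
  ⟨fun _ => trivial⟩

/-- Phase I randomness: `B₁` subsamples of size `k₁` of `m` data points, each with a seed for the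
base learner. -/
abbrev PhaseOne (R : Type*) (k₁ m B₁ : ℕ) := Fin B₁ → (Fin k₁ ↪ Fin m) × R

/-- Phase II randomness: `B₂` subsamples of size `k₂` of `m` data points. -/
abbrev PhaseTwo (k₂ m B₂ : ℕ) := Fin B₂ → (Fin k₂ ↪ Fin m)

/-- All the randomness of one run of the procedure on `n` observations: the data, Phase I (which
subsamples `m₁` of the data points), an auxiliary random element `ξ` (available when the threshold
is chosen and when ties are broken), and Phase II (which subsamples `m₂` of the data points). -/
abbrev Run (Z R Ξ : Type*) (n k₁ m₁ B₁ k₂ m₂ B₂ : ℕ) :=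
  (Fin n → Z) × PhaseOne R k₁ m₁ B₁ × Ξ × PhaseTwo k₂ m₂ B₂

/-- The law of a run: the observations are i.i.d. with law `ν`, all subsamples are uniform, the
seeds are i.i.d. with law `ρ`, the auxiliary element has law `τ`, and all of these are
independent. -/
def runLaw {Z R Ξ : Type*} [MeasurableSpace Z] [MeasurableSpace R] [MeasurableSpace Ξ]
    (ν : Measure Z) (ρ : Measure R) (τ : Measure Ξ) (n k₁ m₁ B₁ k₂ m₂ B₂ : ℕ) :
    Measure (Run Z R Ξ n k₁ m₁ B₁ k₂ m₂ B₂) :=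
  (Measure.pi fun _ : Fin n => ν).prod
    ((Measure.pi fun _ : Fin B₁ =>
        (ProbabilityTheory.uniformOn (Set.univ : Set (Fin k₁ ↪ Fin m₁))).prod ρ).prod
      (τ.prod (Measure.pi fun _ : Fin B₂ =>
        ProbabilityTheory.uniformOn (Set.univ : Set (Fin k₂ ↪ Fin m₂)))))

/-! ### The procedure -/

section Procedure

variable {Z Θ R Ξ : Type*}

/-- The set of models retrieved in Phase I from the data `x`. -/
def retrieved (A : (k : ℕ) → (Fin k → Z) → R → Θ) {k₁ m B₁ : ℕ} (x : Fin m → Z)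
    (u : PhaseOne R k₁ m B₁) : Set Θ :=
  Set.range fun b => A k₁ (fun i => x ((u b).1 i)) (u b).2

/-- The models of `S` whose empirical objective on the sample `y` is at most the minimum over `S`
plus `ε`. -/
def nearOpt (l : Θ → Z → ℝ) (S : Set Θ) {k : ℕ} (y : Fin k → Z) (ε : ℝ) : Set Θ :=
  {θ | θ ∈ S ∧ ∀ θ' ∈ S, empRisk l y θ ≤ empRisk l y θ' + ε}

/-- The number of Phase II subsamples of the data `y` on which `θ` is `ε`-optimal within `S`. -/
def votes (l : Θ → Z → ℝ) (S : Set Θ) (ε : ℝ) {k₂ m B₂ : ℕ} (y : Fin m → Z)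
    (v : PhaseTwo k₂ m B₂) (θ : Θ) : ℕ :=
  ∑ b, (nearOpt l S (fun i => y (v b i)) ε).indicator (fun _ => 1) θ

/-- `θ ∈ argmax_{θ' ∈ S}` of the votes. -/
def IsVoteWinner (l : Θ → Z → ℝ) (S : Set Θ) (ε : ℝ) {k₂ m B₂ : ℕ} (y : Fin m → Z)
    (v : PhaseTwo k₂ m B₂) (θ : Θ) : Prop :=
  θ ∈ S ∧ ∀ θ' ∈ S, votes l S ε y v θ' ≤ votes l S ε y v θ

/-- The observations `z₁, …, z_{⌊n/2⌋}`. -/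
def firstHalf {n : ℕ} (z : Fin n → Z) : Fin (n / 2) → Z :=
  fun i => z ⟨i, by omega⟩

/-- The observations `z_{⌊n/2⌋+1}, …, z_n`. -/
def secondHalf {n : ℕ} (z : Fin n → Z) : Fin (n - n / 2) → Z :=
  fun i => z ⟨n / 2 + i, by omega⟩

/-- A rule choosing the threshold `ε ≥ 0` from `m` data points, the outcome of Phase I and the
auxiliary random element. -/
abbrev ThresholdRule (Z R Ξ : Type*) (k₁ m B₁ : ℕ) :=
  (Fin m → Z) × PhaseOne R k₁ m B₁ × Ξ → ℝ≥0

/-- The threshold chosen in a run with data splitting: only the first half of the data is used. -/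
def splitThreshold {n k₁ B₁ k₂ B₂ : ℕ} (ε : ThresholdRule Z R Ξ k₁ (n / 2) B₁)
    (ω : Run Z R Ξ n k₁ (n / 2) B₁ k₂ (n - n / 2) B₂) : ℝ :=
  ε (firstHalf ω.1, ω.2.1, ω.2.2.1)

/-- The threshold chosen in a run without data splitting. -/
def fullThreshold {n k₁ B₁ k₂ B₂ : ℕ} (ε : ThresholdRule Z R Ξ k₁ n B₁)
    (ω : Run Z R Ξ n k₁ n B₁ k₂ n B₂) : ℝ :=
  ε (ω.1, ω.2.1, ω.2.2.1)

/-- `θ` is a possible output (with arbitrary tie-breaking) of the procedure with data splitting in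
the run `ω`. -/
def IsROVEsOutput (l : Θ → Z → ℝ) (A : (k : ℕ) → (Fin k → Z) → R → Θ) {n k₁ B₁ k₂ B₂ : ℕ}
    (ε : ThresholdRule Z R Ξ k₁ (n / 2) B₁)
    (ω : Run Z R Ξ n k₁ (n / 2) B₁ k₂ (n - n / 2) B₂) (θ : Θ) : Prop :=
  IsVoteWinner l (retrieved A (firstHalf ω.1) ω.2.1) (splitThreshold ε ω)
    (secondHalf ω.1) ω.2.2.2 θ

/-- `θ` is a possible output (with arbitrary tie-breaking) of the procedure without data splitting
in the run `ω`. -/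
def IsROVEOutput (l : Θ → Z → ℝ) (A : (k : ℕ) → (Fin k → Z) → R → Θ) {n k₁ B₁ k₂ B₂ : ℕ}
    (ε : ThresholdRule Z R Ξ k₁ n B₁)
    (ω : Run Z R Ξ n k₁ n B₁ k₂ n B₂) (θ : Θ) : Prop :=
  IsVoteWinner l (retrieved A ω.1 ω.2.1) (fullThreshold ε ω) ω.1 ω.2.2.2 θ

end Procedure

end ROVE

end

/-! The argument reduces both halves of the statement to two events and to one concentration
inequality.

*The vote.* Call a sample of size `k₂` deviating if the empirical objective of some retrieved model
is off by more than `t` (`deviating`). A model that is `δ`-worse than another retrieved model gets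
votes only from deviating subsamples as soon as `ε + 2t ≤ δ` (`votes_le_of_bad`), and the best
retrieved model gets the votes of all other subsamples as soon as `2t ≤ ε` (`le_votes_of_best`). So
if fewer than half of the subsamples deviate, the winner is within `δ` of the best retrieved model
(`risk_le_of_isVoteWinner`). If `ε` may vanish, the second fact is lost, but over a finite model
space every subsample still gives a vote to some model, so the winner has at least `B₂ / |Θ|` votes,
and it is enough that less than a fraction `1 / |Θ|` of the subsamples deviates
(`risk_le_of_isVoteWinner_of_fintype`). If moreover some retrieved model is `δ`-optimal, then the
output is `2δ`-optimal.

*Concentration.* Given the data, the probability that a random subsample is deviating, or that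
it makes the base learner fail, is a U-statistic of the data. Averaging over the permutations of the
data expresses it as a mixture of means of `m / k` independent blocks, so by convexity it satisfies
the Chernoff bound of such a mean (`chernoff_subsampleMean`). Two choices of the exponential
parameter give the two entries of each minimum in the bound: a fixed one gives the exponential, and
one that grows as the mean tends to `0` gives the power of the mean. Given the data, the
subsamples are independent, which adds `exp (-B₁ (1 - 𝓔) / C₇)` in Phase I and, by another Chernoff
bound, `exp (-B₂ / C₃)` in Phase II (`phaseOne_tail`, `phaseTwo_tail`). With data splitting
the retrieved models are independent of the Phase II data, so `phaseTwo_tail` applies conditionally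
on Phase I. Without splitting the deviation is taken over all of the finite model space, and
Markov's inequality for the number of deviating subsamples suffices (`phaseTwo_markov`).

The output need not be a measurable function of the run, so the failure event is always included
in a measurable one before Fubini's theorem is used. -/

namespace ROVE

/-! ### Chernoff bound for independent observations -/

theorem measurePreserving_comp_injective {Z ι κ : Type*} [MeasurableSpace Z] [Fintype ι] [Fintype κ]
    (ν : Measure Z) [IsProbabilityMeasure ν] {h : ι → κ} (hh : Function.Injective h) :
    MeasurePreserving (fun (z : κ → Z) i => z (h i)) (Measure.pi fun _ => ν)
      (Measure.pi fun _ => ν) := by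
  refine ⟨by fun_prop, ?_⟩
  have h1 : ProbabilityTheory.iIndepFun (fun (j : κ) (z : κ → Z) => z j)
      (Measure.pi fun _ => ν) :=
    ProbabilityTheory.iIndepFun_pi (X := fun _ x => x) (fun _ => aemeasurable_id)
  have h2 := (ProbabilityTheory.iIndepFun_iff_map_fun_eq_pi_map
    (fun i => (measurable_pi_apply (h i)).aemeasurable)).1 (h1.precomp hh)
  rw [h2]
  congr 1
  ext1 i
  exact (measurePreserving_eval (fun _ : κ => ν) (h i)).map_eq

/-- Disjoint blocks of an i.i.d. sample are independent, each with the law of a sample. -/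
theorem measurePreserving_blocks {Z ι κ : Type*} [MeasurableSpace Z] [Fintype ι] [Fintype κ]
    {α : Type*} [Fintype α] (ν : Measure Z) [IsProbabilityMeasure ν] {h : ι × κ → α}
    (hh : Function.Injective h) :
    MeasurePreserving (fun (z : α → Z) (j : ι) (i : κ) => z (h (j, i))) (Measure.pi fun _ => ν)
      (Measure.pi fun _ => Measure.pi fun _ => ν) := by
  have h1 : MeasurePreserving (MeasurableEquiv.curry ι κ Z) (Measure.pi fun _ => ν)
      (Measure.pi fun _ => Measure.pi fun _ => ν) := by
    refine ⟨by fun_prop, ?_⟩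
    have := Measure.infinitePi_map_curry (ι := ι) (κ := κ) (fun _ _ => ν)
    simpa only [Measure.infinitePi_eq_pi] using this
  exact h1.comp (measurePreserving_comp_injective ν hh)

theorem integrable_rpow {α : Type*} [MeasurableSpace α] (μ : Measure α) [IsFiniteMeasure μ]
    {g : α → ℝ} (hg : Measurable g) {c s : ℝ} (hc : ∀ x, g x ≤ c)
    (hs : 1 ≤ s) : Integrable (fun x => s ^ g x) μ := by
  refine Integrable.of_bound (C := s ^ c) ?_ (Eventually.of_forall fun x => ?_)
  · exact (measurable_const.pow hg).aestronglyMeasurable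
  · rw [Real.norm_of_nonneg (by positivity)]
    exact Real.rpow_le_rpow_of_exponent_le hs (hc x)

theorem integral_rpow_sum_le {α : Type*} [MeasurableSpace α] (μ : Measure α)
    [IsProbabilityMeasure μ] {f : α → ℝ} (hf : Measurable f) (h0 : ∀ x, 0 ≤ f x)
    (h1 : ∀ x, f x ≤ 1) {p s : ℝ} (hp : ∫ x, f x ∂μ ≤ p) (hs : 1 ≤ s) (N : ℕ) :
    ∫ y, s ^ (∑ j, f (y j)) ∂(Measure.pi fun _ : Fin N => μ) ≤ (1 + p * (s - 1)) ^ N := by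
  have hs0 : 0 < s := by linarith
  simp_rw [Real.rpow_sum_of_pos hs0]
  have := integral_fintype_prod_eq_pow (ι := Fin N) (μ := μ) (fun x => s ^ f x)
  rw [this, Fintype.card_fin]
  have hint : Integrable f μ := Integrable.of_bound (C := 1) hf.aestronglyMeasurable
    (Eventually.of_forall fun x => by rw [Real.norm_of_nonneg (h0 x)]; exact h1 x)
  gcongr
  calc ∫ x, s ^ f x ∂μ ≤ ∫ x, (1 + f x * (s - 1)) ∂μ := by
        refine integral_mono (integrable_rpow μ hf h1 hs) (by fun_prop) fun x => ?_
        have := rpow_one_add_le_one_add_mul_self (s := s - 1) (by linarith) (h0 x) (h1 x)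
        simpa using this
    _ = 1 + (∫ x, f x ∂μ) * (s - 1) := by
        rw [integral_add (by fun_prop) (by fun_prop), integral_mul_const]; simp
    _ ≤ 1 + p * (s - 1) := by gcongr

/-- The exponential Markov inequality, with `s` in place of `e^λ`. -/
theorem measureReal_ge_le_of_integral_rpow_le {α : Type*} [MeasurableSpace α] (μ : Measure α)
    [IsFiniteMeasure μ] {g : α → ℝ} (hg : Measurable g) {a c M s : ℝ}
    (hc : ∀ x, g x ≤ c) (hs : 1 ≤ s) (hM : ∫ x, s ^ g x ∂μ ≤ M) :
    μ.real {x | a ≤ g x} ≤ s ^ (-a) * M := by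
  have hs0 : 0 < s := by linarith
  have h1 := mul_meas_ge_le_integral_of_nonneg (μ := μ) (f := fun x => s ^ g x)
    (Eventually.of_forall fun x => by positivity) (integrable_rpow μ hg hc hs) (s ^ a)
  have h2 : μ.real {x | a ≤ g x} ≤ μ.real {x | s ^ a ≤ s ^ g x} :=
    measureReal_mono fun x hx => Real.rpow_le_rpow_of_exponent_le hs hx
  rw [Real.rpow_neg hs0.le, inv_mul_eq_div, le_div_iff₀ (by positivity), mul_comm]
  calc s ^ a * μ.real {x | a ≤ g x} ≤ s ^ a * μ.real {x | s ^ a ≤ s ^ g x} := by gcongr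
    _ ≤ M := h1.trans hM

theorem rpow_neg_mul_mul_pow {s : ℝ} (hs : 0 < s) (a x : ℝ) (N : ℕ) :
    s ^ (-(N * a)) * x ^ N = (s ^ (-a) * x) ^ N := by
  rw [mul_pow, ← Real.rpow_mul_natCast hs.le]
  ring_nf

theorem sum_fin_le {N : ℕ} {f : Fin N → ℝ} (h1 : ∀ x, f x ≤ 1) : ∑ j, f j ≤ N := by
  simpa using Finset.sum_le_sum (s := Finset.univ) fun j _ => h1 j

theorem chernoff_pi {α : Type*} [MeasurableSpace α] (μ : Measure α) [IsProbabilityMeasure μ]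
    {f : α → ℝ} (hf : Measurable f) (h0 : ∀ x, 0 ≤ f x) (h1 : ∀ x, f x ≤ 1) {a p s : ℝ}
    (hp : ∫ x, f x ∂μ ≤ p) (hs : 1 ≤ s) (N : ℕ) :
    (Measure.pi fun _ : Fin N => μ).real {y | N * a ≤ ∑ j, f (y j)} ≤
      (s ^ (-a) * (1 + p * (s - 1))) ^ N := by
  rw [← rpow_neg_mul_mul_pow (by linarith)]
  exact measureReal_ge_le_of_integral_rpow_le _ (by fun_prop)
    (fun y => sum_fin_le fun j => h1 (y j)) hs
    (integral_rpow_sum_le μ hf h0 h1 hp hs N)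

/-! ### Chernoff bound for U-statistics -/

/-- The complete U-statistic with kernel `f`: the mean of `f` over all subsamples of size `k`
(ordered, without replacement) of `m` data points. -/
noncomputable def subsampleMean {Z : Type*} {k m : ℕ} (f : (Fin k → Z) → ℝ) (z : Fin m → Z) : ℝ :=
  (∑ σ : Fin k ↪ Fin m, f fun i => z (σ i)) / Fintype.card (Fin k ↪ Fin m)

theorem card_subsample_pos {k m : ℕ} (h : k ≤ m) : 0 < Fintype.card (Fin k ↪ Fin m) :=
  Fintype.card_pos_iff.2 ⟨Fin.castLEEmb h⟩

/-- Averaging the kernel over one subsample of a randomly permuted data set gives the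
U-statistic, whichever subsample is used. -/
theorem sum_perm_eq_subsampleMean {Z : Type*} {k m : ℕ} (f : (Fin k → Z) → ℝ) (z : Fin m → Z)
    (e : Fin k ↪ Fin m) :
    ∑ π : Equiv.Perm (Fin m), f (fun i => z (π (e i))) =
      Fintype.card (Equiv.Perm (Fin m)) * subsampleMean f z := by
  have hk : k ≤ m := by simpa using Fintype.card_le_of_embedding e
  have hc : (Fintype.card (Fin k ↪ Fin m) : ℝ) ≠ 0 := by
    exact_mod_cast (card_subsample_pos hk).ne'
  -- both sides arise from the double sum over permutations and injections
  have h1 : ∀ σ : Fin k ↪ Fin m, ∑ π : Equiv.Perm (Fin m), f (fun i => z (π (σ i))) =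
      ∑ π : Equiv.Perm (Fin m), f (fun i => z (π (e i))) := by
    intro σ
    obtain ⟨q, hq⟩ := Equiv.Perm.exists_extending_pair e σ e.injective σ.injective
    refine Fintype.sum_equiv (Equiv.mulRight q) _ _ fun π => ?_
    simp [hq]
  have h2 : ∀ π : Equiv.Perm (Fin m), ∑ σ : Fin k ↪ Fin m, f (fun i => z (π (σ i))) =
      ∑ σ : Fin k ↪ Fin m, f (fun i => z (σ i)) := by
    intro π
    exact Fintype.sum_equiv (Equiv.embeddingCongr (Equiv.refl _) π) _ _ fun σ => by simp
  have h3 := Finset.sum_comm (s := (Finset.univ : Finset (Fin k ↪ Fin m)))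
    (t := (Finset.univ : Finset (Equiv.Perm (Fin m)))) (f := fun σ π => f (fun i => z (π (σ i))))
  simp only [h1, h2, Finset.sum_const, Finset.card_univ, nsmul_eq_mul] at h3
  rw [subsampleMean, mul_div_assoc', eq_div_iff hc, ← h3, mul_comm]

theorem measurable_subsampleMean {Z : Type*} [MeasurableSpace Z] {k m : ℕ}
    {f : (Fin k → Z) → ℝ} (hf : Measurable f) :
    Measurable (subsampleMean (m := m) f) := by
  unfold subsampleMean
  fun_prop

theorem subsampleMean_nonneg {Z : Type*} {k m : ℕ} {f : (Fin k → Z) → ℝ} (h0 : ∀ y, 0 ≤ f y)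
    (z : Fin m → Z) : 0 ≤ subsampleMean f z :=
  div_nonneg (Finset.sum_nonneg fun _ _ => h0 _) (Nat.cast_nonneg _)

theorem subsampleMean_le_one {Z : Type*} {k m : ℕ} {f : (Fin k → Z) → ℝ} (h1 : ∀ y, f y ≤ 1)
    (z : Fin m → Z) : subsampleMean f z ≤ 1 := by
  refine div_le_one_of_le₀ ?_ (Nat.cast_nonneg _)
  simpa using Finset.sum_le_sum (s := Finset.univ) fun (σ : Fin k ↪ Fin m) _ =>
    h1 (fun i => z (σ i))

/-- Hoeffding's device: a U-statistic is an average, over the permutations of the data, of means of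
`N` independent blocks, so that by convexity its exponential moments are bounded by those of such a
mean. -/
theorem chernoff_subsampleMean {Z : Type*} [MeasurableSpace Z] (ν : Measure Z)
    [IsProbabilityMeasure ν] {k m N : ℕ} (hN : 1 ≤ N) (hNk : N * k ≤ m) {f : (Fin k → Z) → ℝ}
    (hf : Measurable f) (h0 : ∀ x, 0 ≤ f x) (h1 : ∀ x, f x ≤ 1) {a p s : ℝ}
    (hp : ∫ x, f x ∂(Measure.pi fun _ => ν) ≤ p) (hs : 1 ≤ s) :
    (Measure.pi fun _ : Fin m => ν).real {z | a ≤ subsampleMean f z} ≤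
      (s ^ (-a) * (1 + p * (s - 1))) ^ N := by
  have hs0 : 0 < s := by linarith
  have hN0 : (0 : ℝ) < N := by exact_mod_cast hN
  obtain ⟨g⟩ : Nonempty (Fin N × Fin k ↪ Fin m) :=
    Function.Embedding.nonempty_of_card_le (by simpa using hNk)
  let P := Equiv.Perm (Fin m)
  have hP : (0 : ℝ) < Fintype.card P := by exact_mod_cast Fintype.card_pos
  let V : P → (Fin m → Z) → ℝ := fun π z => ∑ j, f (fun i => z (π (g (j, i))))
  have hVm : ∀ π, Measurable (V π) := fun π => by fun_prop
  have hV : ∀ π z, V π z ≤ N := fun π z => sum_fin_le fun j => h1 _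
  have hVint : ∀ π, Integrable (fun z => s ^ V π z) (Measure.pi fun _ : Fin m => ν) := fun π =>
    integrable_rpow _ (hVm π) (hV π) hs
  have hVint' : ∀ π, Integrable (fun z => (Fintype.card P : ℝ)⁻¹ • s ^ V π z)
      (Measure.pi fun _ : Fin m => ν) := fun π => (hVint π).const_mul _
  have hmean : ∀ z, N * subsampleMean f z = ∑ π, (Fintype.card P : ℝ)⁻¹ • V π z := by
    intro z
    simp only [V, smul_eq_mul]
    rw [← Finset.mul_sum, Finset.sum_comm]
    have : ∀ j, ∑ π : P, f (fun i => z (π (g (j, i)))) = Fintype.card P * subsampleMean f z :=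
      fun j => sum_perm_eq_subsampleMean f z
        ⟨fun i => g (j, i), fun i i' h => by simpa using h⟩
    simp only [this, Finset.sum_const, Finset.card_univ, Fintype.card_fin, nsmul_eq_mul]
    field_simp
  have hconv : ConvexOn ℝ Set.univ (fun x : ℝ => s ^ x) := by
    have : (fun x : ℝ => s ^ x) = fun x => Real.exp (Real.log s * x) := by
      ext x; rw [Real.rpow_def_of_pos hs0]
    rw [this]
    exact convexOn_exp.comp_linearMap (LinearMap.mulLeft ℝ (Real.log s))
  have hjensen : ∀ z, s ^ (N * subsampleMean f z) ≤
      ∑ π : P, (Fintype.card P : ℝ)⁻¹ • s ^ V π z := by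
    intro z
    rw [hmean z]
    refine hconv.map_sum_le (fun _ _ => by positivity) ?_ (fun _ _ => Set.mem_univ _)
    simp
  have hblock : ∀ π : P, ∫ z, s ^ V π z ∂(Measure.pi fun _ : Fin m => ν) ≤
      (1 + p * (s - 1)) ^ N := by
    intro π
    have hmp := measurePreserving_blocks ν (h := fun q : Fin N × Fin k => π (g q))
      (π.injective.comp g.injective)
    refine le_trans (le_of_eq ?_) (integral_rpow_sum_le (Measure.pi fun _ : Fin k => ν)
      hf h0 h1 hp hs N)
    rw [← hmp.map_eq, integral_map hmp.measurable.aemeasurable]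
    exact (measurable_const.pow (by fun_prop)).aestronglyMeasurable
  have hbound : ∀ z : Fin m → Z, (N : ℝ) * subsampleMean f z ≤ N :=
    fun z => mul_le_of_le_one_right hN0.le (subsampleMean_le_one h1 z)
  have hmeas : Measurable fun z : Fin m → Z => N * subsampleMean f z :=
    (measurable_subsampleMean hf).const_mul _
  have hint : ∫ z, s ^ (N * subsampleMean f z) ∂(Measure.pi fun _ : Fin m => ν) ≤
      (1 + p * (s - 1)) ^ N := by
    calc _ ≤ ∫ z, ∑ π : P, (Fintype.card P : ℝ)⁻¹ • s ^ V π z ∂(Measure.pi fun _ : Fin m => ν) :=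
          integral_mono (integrable_rpow _ hmeas hbound hs)
            (integrable_finsetSum _ fun π _ => hVint' π) hjensen
      _ = ∑ π : P, (Fintype.card P : ℝ)⁻¹ • ∫ z, s ^ V π z ∂(Measure.pi fun _ : Fin m => ν) := by
          rw [integral_finsetSum _ fun π _ => hVint' π]
          simp only [integral_smul]
      _ ≤ ∑ π : P, (Fintype.card P : ℝ)⁻¹ • (1 + p * (s - 1)) ^ N := by
          gcongr with π; exact hblock π
      _ = (1 + p * (s - 1)) ^ N := by simp
  have hset : {z : Fin m → Z | a ≤ subsampleMean f z} =
      {z | N * a ≤ N * subsampleMean f z} := by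
    ext z; exact (mul_le_mul_iff_right₀ hN0).symm
  rw [hset, ← rpow_neg_mul_mul_pow hs0]
  exact measureReal_ge_le_of_integral_rpow_le _ hmeas hbound hs hint

/-! ### Numerical form of the Chernoff bounds -/

/-- The choice `s = 1 / p` in the Chernoff bound, or `s → ∞` if `p = 0`. -/
theorem le_two_mul_rpow_pow_of_chernoff {P a p : ℝ} {N : ℕ} (hN : 1 ≤ N) (ha : 0 < a)
    (hp0 : 0 ≤ p) (hp1 : p ≤ 1)
    (h : ∀ s : ℝ, 1 ≤ s → P ≤ (s ^ (-a) * (1 + p * (s - 1))) ^ N) : P ≤ (2 * p ^ a) ^ N := by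
  rcases hp0.eq_or_lt with rfl | hp
  · rw [Real.zero_rpow ha.ne', mul_zero, zero_pow (by omega)]
    have h1 : Tendsto (fun s : ℝ => (s ^ (-a) * (1 + 0 * (s - 1))) ^ N) atTop (𝓝 0) := by
      have := (tendsto_rpow_neg_atTop ha).pow N
      rw [zero_pow (by omega)] at this
      simpa using this
    exact ge_of_tendsto h1 ((eventually_ge_atTop 1).mono fun s hs => h s hs)
  · refine (h p⁻¹ (by rw [one_le_inv₀ hp]; exact hp1)).trans ?_
    rw [Real.rpow_neg (by positivity), Real.inv_rpow hp.le, inv_inv, mul_comm]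
    have h1 : p * (p⁻¹ - 1) = 1 - p := by field_simp
    rw [h1]
    gcongr
    nlinarith

theorem pow_le_rpow_of_le {M x c : ℝ} {N : ℕ} (hM0 : 0 ≤ M) (hM1 : M ≤ 1) (hx : 0 ≤ x)
    (hxN : x ≤ c * N) : (M ^ c) ^ N ≤ M ^ x := by
  rw [← Real.rpow_mul_natCast hM0]
  exact Real.rpow_le_rpow_of_exponent_ge_of_imp hM0 hM1 hxN fun _ h0 => by linarith

/-- Both bounds needed for a kernel with mean `p ≤ 1/5` to have U-statistic at least `2/5`: a
geometric one, with `s = (6/5)^5`, and one that improves with `p`. -/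
theorem le_min_rpow_of_chernoff_two_fifths {P p x : ℝ} {N : ℕ} (hN : 1 ≤ N) (hp0 : 0 ≤ p)
    (hp1 : p ≤ 1 / 5)
    (h : ∀ s : ℝ, 1 ≤ s → P ≤ (s ^ (-(2 / 5 : ℝ)) * (1 + p * (s - 1))) ^ N)
    (hx0 : 0 ≤ x) (hx : x ≤ 1 / 4 * N) : P ≤ min (Real.exp (-2 / 5)) (6 * p) ^ x := by
  rcases min_cases (Real.exp (-2 / 5)) (6 * p) with ⟨h1, h2⟩ | ⟨h1, h2⟩
  · rw [h1]
    refine le_trans ?_ (pow_le_rpow_of_le (Real.exp_pos _).le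
      (Real.exp_le_one_iff.2 (by norm_num)) hx0 hx)
    refine (h ((6 / 5) ^ (5 : ℕ)) (by norm_num)).trans ?_
    have h3 : (((6 : ℝ) / 5) ^ (5 : ℕ)) ^ (-(2 / 5 : ℝ)) = 25 / 36 := by
      rw [← Real.rpow_natCast, ← Real.rpow_mul (by norm_num)]
      norm_num [Real.rpow_neg]
    have h4 : (0.9047 : ℝ) ≤ Real.exp (-2 / 5 * (1 / 4)) := by
      have h6 : (Real.exp (-2 / 5 * (1 / 4))) ^ 10 = Real.exp (-1) := by
        rw [← Real.exp_nat_mul]; norm_num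
      refine le_of_pow_le_pow_left₀ (n := 10) (by norm_num) (Real.exp_pos _).le ?_
      rw [h6]
      exact le_trans (by norm_num) Real.exp_neg_one_gt_d9.le
    rw [h3, ← Real.exp_mul]
    gcongr
    refine le_trans ?_ h4
    nlinarith
  · rw [h1]
    refine le_trans ?_ (pow_le_rpow_of_le (c := 2 / 5) (by positivity)
      (h2.le.trans (Real.exp_le_one_iff.2 (by norm_num))) hx0
      (hx.trans (mul_le_mul_of_nonneg_right (by norm_num) (Nat.cast_nonneg N))))
    refine (le_two_mul_rpow_pow_of_chernoff hN (by norm_num) hp0 (by linarith) h).trans ?_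
    rw [Real.mul_rpow (by norm_num) hp0]
    gcongr
    refine le_of_pow_le_pow_left₀ (n := 5) (by norm_num) (by positivity) ?_
    rw [← Real.rpow_mul_natCast (by norm_num)]
    norm_num

/-- The geometric bound for a kernel with mean `p` to have U-statistic at least `(1 + p) / 2`, from
the choice `s = 2`. -/
theorem le_exp_pow_of_chernoff_midpoint {P p : ℝ} {N : ℕ} (hp0 : 0 ≤ p) (hp1 : p ≤ 1)
    (h : ∀ s : ℝ, 1 ≤ s → P ≤ (s ^ (-((1 + p) / 2)) * (1 + p * (s - 1))) ^ N) :
    P ≤ Real.exp (-(1 - p) / 7) ^ N := by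
  refine (h 2 (by norm_num)).trans ?_
  have h1 : (2 : ℝ) ^ (-((1 + p) / 2)) = Real.exp (Real.log 2 * ((1 - p) / 2)) / 2 := by
    rw [Real.rpow_def_of_pos (by norm_num), eq_div_iff (by norm_num)]
    calc _ = Real.exp (Real.log 2 * -((1 + p) / 2)) * Real.exp (Real.log 2) := by
          rw [Real.exp_log (by norm_num)]
      _ = _ := by rw [← Real.exp_add]; ring_nf
  have h2 : 1 - (1 - p) / 2 ≤ Real.exp (-((1 - p) / 2)) := Real.one_sub_le_exp_neg _
  gcongr
  calc (2 : ℝ) ^ (-((1 + p) / 2)) * (1 + p * (2 - 1))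
      = Real.exp (Real.log 2 * ((1 - p) / 2)) * (1 - (1 - p) / 2) := by rw [h1]; ring
    _ ≤ Real.exp (Real.log 2 * ((1 - p) / 2)) * Real.exp (-((1 - p) / 2)) := by gcongr
    _ = Real.exp (Real.log 2 * ((1 - p) / 2) + -((1 - p) / 2)) := (Real.exp_add _ _).symm
    _ ≤ Real.exp (-(1 - p) / 7) := by
        gcongr
        nlinarith [Real.log_two_lt_d9]

/-- Both bounds needed for a kernel with mean `p` to have U-statistic at least `(1 + p) / 2`. -/
theorem le_min_rpow_of_chernoff_midpoint {P p x : ℝ} {N : ℕ} (hN : 1 ≤ N) (hp0 : 0 ≤ p)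
    (hp1 : p ≤ 1)
    (h : ∀ s : ℝ, 1 ≤ s → P ≤ (s ^ (-((1 + p) / 2)) * (1 + p * (s - 1))) ^ N)
    (hx0 : 0 ≤ x) (hx : x ≤ 1 / 2 * N) :
    P ≤ min (Real.exp (-(1 - p) / 7)) (4 * p) ^ x := by
  have hM1 : Real.exp (-(1 - p) / 7) ≤ 1 := Real.exp_le_one_iff.2 (by linarith)
  rcases min_cases (Real.exp (-(1 - p) / 7)) (4 * p) with ⟨h1, h2⟩ | ⟨h1, h2⟩
  · rw [h1]
    refine le_trans ?_ (pow_le_rpow_of_le (c := 1) (Real.exp_pos _).le hM1 hx0 (by linarith))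
    rw [Real.rpow_one]
    exact le_exp_pow_of_chernoff_midpoint hp0 hp1 h
  · rw [h1]
    refine le_trans ?_ (pow_le_rpow_of_le (c := 1 / 2) (by positivity) (h2.le.trans hM1) hx0 hx)
    refine (le_two_mul_rpow_pow_of_chernoff hN (by linarith) hp0 hp1 h).trans ?_
    rw [Real.mul_rpow (by norm_num) hp0]
    have h4 : (4 : ℝ) ^ (1 / 2 : ℝ) = 2 := by
      rw [← Real.sqrt_eq_rpow, show (4 : ℝ) = 2 ^ 2 by norm_num, Real.sqrt_sq (by norm_num)]
    rw [h4]
    gcongr (2 * ?_) ^ N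
    exact Real.rpow_le_rpow_of_exponent_ge_of_imp hp0 hp1 (by linarith) fun _ h0 => by linarith

/-- The choice `s = 3/2` in the Chernoff bound for a mean `2/5` to be exceeded by `1/10`. -/
theorem chernoff_two_fifths_one_half_le (N : ℕ) :
    (((3 : ℝ) / 2) ^ (-(1 / 2 : ℝ)) * (1 + 2 / 5 * (3 / 2 - 1))) ^ N ≤
      Real.exp (-(N : ℝ) / 100) := by
  have h1 : Real.exp (-(N : ℝ) / 100) = Real.exp (-(1 / 100)) ^ N := by
    rw [← Real.exp_nat_mul]; ring_nf
  rw [h1]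
  gcongr
  refine le_of_pow_le_pow_left₀ (n := 2) (by norm_num) (Real.exp_pos _).le ?_
  rw [mul_pow, ← Real.rpow_mul_natCast (by norm_num), ← Real.exp_nat_mul]
  have := Real.add_one_le_exp ((2 : ℕ) * -(1 / 100) : ℝ)
  refine le_trans ?_ this
  norm_num [Real.rpow_neg]

/-! ### Sections of product measures and uniform subsampling -/

theorem measureReal_prod_eq_integral {α β : Type*} [MeasurableSpace α] [MeasurableSpace β]
    (μ : Measure α) (κ : Measure β) [IsProbabilityMeasure κ] {E : Set (α × β)}
    (hE : MeasurableSet E) : (μ.prod κ).real E = ∫ x, κ.real (Prod.mk x ⁻¹' E) ∂μ := by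
  rw [measureReal_def, Measure.prod_apply hE]
  exact (integral_toReal (measurable_measure_prodMk_left hE).aemeasurable
    (Eventually.of_forall fun x => measure_lt_top _ _)).symm

theorem measurable_measureReal_section {α β : Type*} [MeasurableSpace α] [MeasurableSpace β]
    (κ : Measure β) [IsProbabilityMeasure κ] {E : Set (α × β)}
    (hE : MeasurableSet E) : Measurable fun x => κ.real (Prod.mk x ⁻¹' E) :=
  (measurable_measure_prodMk_left hE).ennreal_toReal

/-- If all sections of `E` outside an exceptional set `D` have measure at most `c`, then `E` has
measure at most `c` plus the measure of `D`. -/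
theorem measureReal_prod_le_add {α β : Type*} [MeasurableSpace α] [MeasurableSpace β]
    (μ : Measure α) (κ : Measure β) [IsProbabilityMeasure μ] [IsProbabilityMeasure κ]
    {E : Set (α × β)} (hE : MeasurableSet E) {D : Set α} (hD : MeasurableSet D) {c : ℝ}
    (hc0 : 0 ≤ c) (hc : ∀ x ∉ D, κ.real (Prod.mk x ⁻¹' E) ≤ c) :
    (μ.prod κ).real E ≤ μ.real D + c := by
  rw [measureReal_prod_eq_integral μ κ hE]
  have hD1 : Integrable (D.indicator fun _ => (1 : ℝ)) μ := (integrable_const _).indicator hD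
  have hE1 : Integrable (fun x => κ.real (Prod.mk x ⁻¹' E)) μ :=
    Integrable.of_bound (C := 1) (measurable_measureReal_section κ hE).aestronglyMeasurable
      (Eventually.of_forall fun x => by
        rw [Real.norm_of_nonneg measureReal_nonneg]; exact measureReal_le_one)
  calc ∫ x, κ.real (Prod.mk x ⁻¹' E) ∂μ ≤ ∫ x, (D.indicator (fun _ => (1 : ℝ)) x + c) ∂μ := by
        refine integral_mono hE1 (hD1.add (integrable_const c)) fun x => ?_
        by_cases hx : x ∈ D
        · simpa [hx] using (measureReal_le_one (μ := κ)).trans (by linarith : (1 : ℝ) ≤ 1 + c)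
        · simpa [hx] using hc x hx
    _ = μ.real D + c := by
        rw [integral_add hD1 (integrable_const c), integral_indicator_const _ hD]; simp

theorem nonempty_subsample {k m : ℕ} (h : k ≤ m) : Nonempty (Fin k ↪ Fin m) :=
  ⟨Fin.castLEEmb h⟩

theorem integral_uniformOn_univ {α : Type*} [Fintype α] [MeasurableSpace α]
    [MeasurableSingletonClass α] [Nonempty α] (g : α → ℝ) :
    ∫ x, g x ∂(ProbabilityTheory.uniformOn (Set.univ : Set α)) = (∑ x, g x) / Fintype.card α := by
  rw [integral_fintype (Integrable.of_finite), Finset.sum_div]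
  refine Finset.sum_congr rfl fun x _ => ?_
  rw [measureReal_def, ProbabilityTheory.uniformOn_univ]
  simp [div_eq_inv_mul]

/-- A uniform subsample together with independent seeds hits `H` with probability the U-statistic
whose kernel is the probability of `H` over the seed. -/
theorem measureReal_uniform_prod {Z R : Type*} [MeasurableSpace Z] [MeasurableSpace R]
    (ρ : Measure R) [IsProbabilityMeasure ρ] {k m : ℕ} (hkm : k ≤ m) {H : Set ((Fin k → Z) × R)}
    (hH : MeasurableSet H) (x : Fin m → Z) :
    ((ProbabilityTheory.uniformOn (Set.univ : Set (Fin k ↪ Fin m))).prod ρ).real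
      {q | ((fun i => x (q.1 i)), q.2) ∈ H} =
    subsampleMean (fun y => ρ.real (Prod.mk y ⁻¹' H)) x := by
  have := nonempty_subsample hkm
  rw [measureReal_prod_eq_integral, integral_uniformOn_univ]
  · rfl
  · have : Measurable fun q : (Fin k ↪ Fin m) × R => ((fun i => x (q.1 i)), q.2) :=
      measurable_from_prod_countable_right fun σ => by fun_prop
    exact this hH

theorem integral_indicator_one_uniform {Z : Type*} {k m : ℕ} (hkm : k ≤ m) (G : Set (Fin k → Z))
    (y : Fin m → Z) :
    ∫ σ, G.indicator (fun _ => (1 : ℝ)) (fun i => y (σ i))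
      ∂(ProbabilityTheory.uniformOn (Set.univ : Set (Fin k ↪ Fin m))) =
    subsampleMean (G.indicator fun _ => 1) y := by
  have := nonempty_subsample hkm
  exact integral_uniformOn_univ _

theorem measurable_resample (Z : Type*) [MeasurableSpace Z] (k m : ℕ) :
    Measurable fun q : (Fin m → Z) × (Fin k ↪ Fin m) => fun i => q.1 (q.2 i) :=
  measurable_from_prod_countable_left fun σ =>
    measurable_pi_lambda _ fun i => measurable_pi_apply (σ i)

theorem measurable_resample_seed (Z R : Type*) [MeasurableSpace Z] [MeasurableSpace R] (k m : ℕ) :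
    Measurable fun q : (Fin m → Z) × ((Fin k ↪ Fin m) × R) =>
      ((fun i => q.1 (q.2.1 i)), q.2.2) := by
  have := measurable_resample Z k m
  exact (this.comp (by fun_prop : Measurable fun q : (Fin m → Z) × ((Fin k ↪ Fin m) × R) =>
    (q.1, q.2.1))).prodMk (by fun_prop)

/-! ### The tail bounds of the two phases -/

/-- If `k₁` observations and a seed land in `H` with probability `p`, then all `B` subsamples land
in `H` only if the conditional probability of `H` given the data is at least `(1 + p) / 2`, or by a
coincidence of the resampling. -/
theorem phaseOne_tail {Z R : Type*} [MeasurableSpace Z] [MeasurableSpace R]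
    (ν : Measure Z) [IsProbabilityMeasure ν] (ρ : Measure R) [IsProbabilityMeasure ρ]
    {k m N : ℕ} (B : ℕ) (hN : 1 ≤ N) (hNk : N * k ≤ m)
    {H : Set ((Fin k → Z) × R)} (hH : MeasurableSet H) {p x : ℝ}
    (hp : ((Measure.pi fun _ => ν).prod ρ).real H = p) (hx0 : 0 ≤ x) (hx : x ≤ 1 / 2 * N) :
    ((Measure.pi fun _ : Fin m => ν).prod (Measure.pi fun _ : Fin B =>
        (ProbabilityTheory.uniformOn (Set.univ : Set (Fin k ↪ Fin m))).prod ρ)).real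
      {q | ∀ b, ((fun i => q.1 ((q.2 b).1 i)), (q.2 b).2) ∈ H} ≤
    min (Real.exp (-(1 - p) / 7)) (4 * p) ^ x + Real.exp (-(B : ℝ) * (1 - p) / 2) := by
  have hkm : k ≤ m := le_trans (Nat.le_mul_of_pos_left k hN) hNk
  have := nonempty_subsample hkm
  have hp0 : 0 ≤ p := hp ▸ measureReal_nonneg
  have hp1 : p ≤ 1 := hp ▸ measureReal_le_one
  set f : (Fin k → Z) → ℝ := fun y => ρ.real (Prod.mk y ⁻¹' H) with hf
  have hfm : Measurable f := measurable_measureReal_section ρ hH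
  have hf0 : ∀ y, 0 ≤ f y := fun y => measureReal_nonneg
  have hf1 : ∀ y, f y ≤ 1 := fun y => measureReal_le_one
  have hfp : ∫ y, f y ∂(Measure.pi fun _ => ν) ≤ p := by
    rw [← hp, measureReal_prod_eq_integral _ _ hH]
  have hU := le_min_rpow_of_chernoff_midpoint hN hp0 hp1
    (fun s hs => chernoff_subsampleMean ν hN hNk hfm hf0 hf1 (a := (1 + p) / 2) hfp hs) hx0 hx
  refine le_trans (measureReal_prod_le_add _ _ ?_ (D := {z | (1 + p) / 2 ≤ subsampleMean f z})
    ?_ (Real.exp_pos (-(B : ℝ) * (1 - p) / 2)).le ?_) (add_le_add_left hU _)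
  · rw [Set.ofPred_forall]
    refine MeasurableSet.iInter fun b => ?_
    exact ((measurable_resample_seed Z R k m).comp (by fun_prop :
      Measurable fun q : (Fin m → Z) × (Fin B → (Fin k ↪ Fin m) × R) => (q.1, q.2 b))) hH
  · exact measurableSet_le measurable_const (measurable_subsampleMean hfm)
  · intro z hz
    have h1 : (Prod.mk z ⁻¹' {q : (Fin m → Z) × (Fin B → (Fin k ↪ Fin m) × R) |
        ∀ b, ((fun i => q.1 ((q.2 b).1 i)), (q.2 b).2) ∈ H}) =
        Set.univ.pi fun _ : Fin B => {q | ((fun i => z (q.1 i)), q.2) ∈ H} := by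
      ext u; simp
    rw [h1, measureReal_def, Measure.pi_pi, Finset.prod_const, ENNReal.toReal_pow,
      ← measureReal_def, measureReal_uniform_prod ρ hkm hH, Finset.card_univ, Fintype.card_fin]
    have h2 : subsampleMean f z ≤ Real.exp (-((1 - p) / 2)) := by
      have := Real.one_sub_le_exp_neg ((1 - p) / 2)
      simp only [Set.mem_ofPred_eq, not_le] at hz
      linarith
    calc _ ≤ Real.exp (-((1 - p) / 2)) ^ B := by
          gcongr
          exact subsampleMean_nonneg hf0 z
      _ = _ := by rw [← Real.exp_nat_mul]; ring_nf

/-- If `k` observations land in `G` with probability at most `p ≤ 1/5`, then at least half of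
`B` subsamples land in `G` only if at least `2/5` of all subsamples do, or by a coincidence of the resampling. -/
theorem phaseTwo_tail {Z : Type*} [MeasurableSpace Z]
    (ν : Measure Z) [IsProbabilityMeasure ν] {k m N : ℕ} (B : ℕ)
    (hN : 1 ≤ N) (hNk : N * k ≤ m) {G : Set (Fin k → Z)} (hG : MeasurableSet G) {p x : ℝ}
    (hp : (Measure.pi fun _ => ν).real G ≤ p) (hp1 : p ≤ 1 / 5) (hx0 : 0 ≤ x)
    (hx : x ≤ 1 / 4 * N) :
    ((Measure.pi fun _ : Fin m => ν).prod (Measure.pi fun _ : Fin B =>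
        ProbabilityTheory.uniformOn (Set.univ : Set (Fin k ↪ Fin m)))).real
      {q | B * (1 / 2 : ℝ) ≤ ∑ b, G.indicator (fun _ => 1) (fun i => q.1 (q.2 b i))} ≤
    min (Real.exp (-2 / 5)) (6 * p) ^ x + Real.exp (-(B : ℝ) / 100) := by
  have hkm : k ≤ m := le_trans (Nat.le_mul_of_pos_left k hN) hNk
  have := nonempty_subsample hkm
  have hp0 : 0 ≤ p := measureReal_nonneg.trans hp
  set f : (Fin k → Z) → ℝ := G.indicator fun _ => 1 with hf
  have hfm : Measurable f := measurable_const.indicator hG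
  have hf0 : ∀ y, 0 ≤ f y := fun y => Set.indicator_nonneg (fun _ _ => zero_le_one) y
  have hf1 : ∀ y, f y ≤ 1 := fun y => Set.indicator_le_self' (fun _ _ => zero_le_one) y
  have hfp : ∫ y, f y ∂(Measure.pi fun _ => ν) ≤ p := by
    rw [hf, integral_indicator_const _ hG]; simpa using hp
  have hU := le_min_rpow_of_chernoff_two_fifths hN hp0 hp1
    (fun s hs => chernoff_subsampleMean ν hN hNk hfm hf0 hf1 (a := 2 / 5) hfp hs) hx0 hx
  refine le_trans (measureReal_prod_le_add _ _ ?_ (D := {z | 2 / 5 ≤ subsampleMean f z})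
    ?_ (Real.exp_pos (-(B : ℝ) / 100)).le ?_) (add_le_add_left hU _)
  · refine measurableSet_le measurable_const (Finset.measurable_sum _ fun b _ => ?_)
    exact hfm.comp ((measurable_resample Z k m).comp (by fun_prop :
      Measurable fun q : (Fin m → Z) × (Fin B → (Fin k ↪ Fin m)) => (q.1, q.2 b)))
  · exact measurableSet_le measurable_const (measurable_subsampleMean hfm)
  · intro z hz
    refine le_trans ?_ (chernoff_two_fifths_one_half_le B)
    refine chernoff_pi (ProbabilityTheory.uniformOn (Set.univ : Set (Fin k ↪ Fin m)))
      (f := fun σ => f fun i => z (σ i)) (.of_discrete) (fun _ => hf0 _) (fun _ => hf1 _)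
      ?_ (by norm_num) B
    rw [hf, integral_indicator_one_uniform hkm G z]
    exact (not_le.1 hz).le

/-- Markov's inequality for the number of subsamples that land in `G`. -/
theorem phaseTwo_markov {Z : Type*} [MeasurableSpace Z]
    (ν : Measure Z) [IsProbabilityMeasure ν] {k m B : ℕ} (hkm : k ≤ m) (hB : 1 ≤ B)
    {G : Set (Fin k → Z)} (hG : MeasurableSet G) {c : ℝ} (hc : 0 < c) :
    ((Measure.pi fun _ : Fin m => ν).prod (Measure.pi fun _ : Fin B =>
        ProbabilityTheory.uniformOn (Set.univ : Set (Fin k ↪ Fin m)))).real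
      {q | (B : ℝ) ≤ c * ∑ b, G.indicator (fun _ => 1) (fun i => q.1 (q.2 b i))} ≤
    c * (Measure.pi fun _ => ν).real G := by
  have := nonempty_subsample hkm
  set Q := (Measure.pi fun _ : Fin m => ν).prod (Measure.pi fun _ : Fin B =>
        ProbabilityTheory.uniformOn (Set.univ : Set (Fin k ↪ Fin m)))
  set p := (Measure.pi fun _ : Fin k => ν).real G
  have hB0 : (0 : ℝ) < B := by exact_mod_cast hB
  have hmeas : ∀ b : Fin B, Measurable fun q : (Fin m → Z) × (Fin B → (Fin k ↪ Fin m)) =>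
      fun i => q.1 (q.2 b i) := fun b =>
    (measurable_resample Z k m).comp (by fun_prop :
      Measurable fun q : (Fin m → Z) × (Fin B → (Fin k ↪ Fin m)) => (q.1, q.2 b))
  have hS : ∀ b : Fin B, MeasurableSet
      {q : (Fin m → Z) × (Fin B → (Fin k ↪ Fin m)) | (fun i => q.1 (q.2 b i)) ∈ G} :=
    fun b => hmeas b hG
  -- each single subsample has the law of an i.i.d. sample of size `k`
  have h1 : ∀ b : Fin B, Q.real {q | (fun i => q.1 (q.2 b i)) ∈ G} ≤ p := by
    intro b
    have h2 := Measure.measurePreserving_swap (μ := Measure.pi fun _ : Fin B =>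
        ProbabilityTheory.uniformOn (Set.univ : Set (Fin k ↪ Fin m)))
      (ν := Measure.pi fun _ : Fin m => ν)
    rw [← h2.measureReal_preimage (hS b).nullMeasurableSet]
    have h3 := measureReal_prod_le_add (Measure.pi fun _ : Fin B =>
        ProbabilityTheory.uniformOn (Set.univ : Set (Fin k ↪ Fin m)))
      (Measure.pi fun _ : Fin m => ν) (h2.measurable (hS b)) MeasurableSet.empty
      (c := p) measureReal_nonneg (fun v _ => le_of_eq
        ((measurePreserving_comp_injective ν (v b).injective).measureReal_preimage
          hG.nullMeasurableSet))
    simpa using h3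
  have hint : ∀ b : Fin B, Integrable (fun q : (Fin m → Z) × (Fin B → (Fin k ↪ Fin m)) =>
      G.indicator (fun _ => (1 : ℝ)) (fun i => q.1 (q.2 b i))) Q := fun b =>
    (integrable_const (1 : ℝ)).indicator (hS b)
  have h4 : ∫ q, c * ∑ b, G.indicator (fun _ => (1 : ℝ)) (fun i => q.1 (q.2 b i)) ∂Q ≤
      c * (B * p) := by
    rw [integral_const_mul, integral_finsetSum _ fun b _ => hint b]
    gcongr
    have : ∀ b : Fin B, ∫ q, G.indicator (fun _ => (1 : ℝ)) (fun i => q.1 (q.2 b i)) ∂Q ≤ p := by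
      intro b
      refine le_trans (le_of_eq ?_) (h1 b)
      exact (integral_indicator_const (1 : ℝ) (hS b)).trans (by simp)
    simpa using Finset.sum_le_sum (s := Finset.univ) fun b _ => this b
  have h5 := mul_meas_ge_le_integral_of_nonneg (μ := Q)
    (f := fun q => c * ∑ b, G.indicator (fun _ => (1 : ℝ)) (fun i => q.1 (q.2 b i)))
    (Eventually.of_forall fun q => mul_nonneg hc.le (Finset.sum_nonneg fun b _ =>
      Set.indicator_nonneg (fun _ _ => zero_le_one) _))
    ((integrable_finsetSum _ fun b _ => hint b).const_mul c) B
  have h6 := h5.trans h4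
  rw [mul_left_comm] at h6
  exact le_of_mul_le_mul_left h6 hB0

/-! ### Samples on which the empirical objective deviates, and the vote -/

/-- The samples on which the empirical objective of some model of `S` deviates from its population
objective by more than `t`. -/
def deviating {Z Θ : Type*} [MeasurableSpace Z] (ν : Measure Z) (l : Θ → Z → ℝ) (t : ℝ)
    (S : Set Θ) (k : ℕ) : Set (Fin k → Z) :=
  {y | ∃ θ ∈ S, t < |empRisk l y θ - risk ν l θ|}

theorem cast_votes {Z Θ : Type*} (l : Θ → Z → ℝ) (S : Set Θ) (ε : ℝ) {k m B : ℕ}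
    (y : Fin m → Z) (v : PhaseTwo k m B) (θ : Θ) :
    (votes l S ε y v θ : ℝ) =
      ∑ b, (nearOpt l S (fun i => y (v b i)) ε).indicator (fun _ => (1 : ℝ)) θ := by
  classical
  simp [votes, Set.indicator_apply]

/-- Every subsample gives at least one vote. -/
theorem le_sum_votes {Z Θ : Type*} [Fintype Θ] (l : Θ → Z → ℝ) {S : Set Θ} (hS : S.Nonempty)
    {ε : ℝ} (hε : 0 ≤ ε) {k m B : ℕ}
    (y : Fin m → Z) (v : PhaseTwo k m B) : (B : ℝ) ≤ ∑ θ, (votes l S ε y v θ : ℝ) := by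
  simp only [cast_votes]
  rw [Finset.sum_comm]
  have : (B : ℝ) = ∑ _b : Fin B, (1 : ℝ) := by simp
  rw [this]
  refine Finset.sum_le_sum fun b _ => ?_
  obtain ⟨θ₀, hθ₀, hbest⟩ := Set.exists_min_image S (empRisk l fun i => y (v b i)) S.toFinite hS
  have h1 : θ₀ ∈ nearOpt l S (fun i => y (v b i)) ε := ⟨hθ₀, fun θ' hθ' => by
    linarith [hbest θ' hθ']⟩
  calc (1 : ℝ) = (nearOpt l S (fun i => y (v b i)) ε).indicator (fun _ => (1 : ℝ)) θ₀ := by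
        simp [h1]
    _ ≤ _ := Finset.single_le_sum
        (f := (nearOpt l S (fun i => y (v b i)) ε).indicator (fun _ => (1 : ℝ)))
        (fun θ _ => Set.indicator_nonneg (fun _ _ => zero_le_one) _) (Finset.mem_univ θ₀)

section Vote

variable {Z Θ : Type*} [MeasurableSpace Z] {ν : Measure Z} {l : Θ → Z → ℝ}

theorem abs_sub_le_of_notMem_deviating {t : ℝ} {S : Set Θ} {k : ℕ} {y : Fin k → Z} {θ : Θ}
    (hy : y ∉ deviating ν l t S k) (hθ : θ ∈ S) : |empRisk l y θ - risk ν l θ| ≤ t := by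
  by_contra h
  exact hy ⟨θ, hθ, not_le.1 h⟩

theorem measureReal_deviating_le_devTail [IsProbabilityMeasure ν] (t : ℝ) (S : Set Θ) (k : ℕ) :
    (Measure.pi fun _ => ν).real (deviating ν l t S k) ≤ devTail ν l k t := by
  refine measureReal_mono fun y hy => ?_
  obtain ⟨θ, -, h⟩ := hy
  exact lt_of_lt_of_le (EReal.coe_lt_coe_iff.2 h)
    (le_iSup (fun θ => ((|empRisk l y θ - risk ν l θ| : ℝ) : EReal)) θ)

/-- A model that is `δ`-worse than another one gets votes from deviating subsamples only. -/
theorem votes_le_of_bad {S : Set Θ} {ε t δ : ℝ} {k m B : ℕ} {y : Fin m → Z} {v : PhaseTwo k m B}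
    (ht : ε + 2 * t ≤ δ) {θ θ' : Θ} (hθ' : θ' ∈ S) (hbad : risk ν l θ' + δ < risk ν l θ) :
    (votes l S ε y v θ : ℝ) ≤
      ∑ b, (deviating ν l t S k).indicator (fun _ => (1 : ℝ)) (fun i => y (v b i)) := by
  classical
  rw [cast_votes]
  refine Finset.sum_le_sum fun b _ => ?_
  simp only [Set.indicator_apply]
  split_ifs with h1 h2 <;> try norm_num
  have h3 := abs_le.1 (abs_sub_le_of_notMem_deviating h2 h1.1)
  have h4 := abs_le.1 (abs_sub_le_of_notMem_deviating h2 hθ')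
  have h5 := h1.2 θ' hθ'
  linarith [h3.1, h4.2]

/-- The best model of `S` gets votes from all subsamples that do not deviate. -/
theorem le_votes_of_best {S : Set Θ} {ε t : ℝ} {k m B : ℕ} {y : Fin m → Z} {v : PhaseTwo k m B}
    (ht : 2 * t ≤ ε) {θ : Θ} (hθ : θ ∈ S) (hbest : ∀ θ' ∈ S, risk ν l θ ≤ risk ν l θ') :
    (B : ℝ) - ∑ b, (deviating ν l t S k).indicator (fun _ => (1 : ℝ)) (fun i => y (v b i)) ≤
      votes l S ε y v θ := by
  classical
  rw [cast_votes, sub_le_iff_le_add, ← Finset.sum_add_distrib]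
  have : (B : ℝ) = ∑ _b : Fin B, (1 : ℝ) := by simp
  rw [this]
  refine Finset.sum_le_sum fun b _ => ?_
  simp only [Set.indicator_apply]
  split_ifs with h1 h2 h2 <;> try norm_num
  refine h1 ⟨hθ, fun θ' hθ' => ?_⟩
  have h3 := abs_le.1 (abs_sub_le_of_notMem_deviating h2 hθ)
  have h4 := abs_le.1 (abs_sub_le_of_notMem_deviating h2 hθ')
  linarith [h3.2, h4.1, hbest θ' hθ']

/-- If fewer than half of the subsamples deviate, the winner of the vote is within `δ` of every
model of `S`. -/
theorem risk_le_of_isVoteWinner {S : Set Θ} (hS : S.Finite) {ε t δ : ℝ} {k m B : ℕ}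
    {y : Fin m → Z} {v : PhaseTwo k m B} (h1 : 2 * t ≤ ε) (h2 : ε + 2 * t ≤ δ) {θ θ' : Θ}
    (hθ : IsVoteWinner l S ε y v θ) (hθ' : θ' ∈ S)
    (hdev : ∑ b, (deviating ν l t S k).indicator (fun _ => (1 : ℝ)) (fun i => y (v b i)) <
      B * (1 / 2 : ℝ)) :
    risk ν l θ ≤ risk ν l θ' + δ := by
  by_contra hbad
  obtain ⟨θ₀, hθ₀, hbest⟩ := Set.exists_min_image S (risk ν l) hS ⟨θ', hθ'⟩
  have h3 := votes_le_of_bad (y := y) (v := v) h2 hθ' (not_le.1 hbad)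
  have h4 := le_votes_of_best (ν := ν) (y := y) (v := v) h1 hθ₀ hbest
  have h5 : (votes l S ε y v θ₀ : ℝ) ≤ votes l S ε y v θ := by exact_mod_cast hθ.2 θ₀ hθ₀
  linarith

/-- Over a finite model space the winner gets at least the average number of votes, so it is within
`δ` of every model of `S` unless a fraction `1 / |Θ|` of the subsamples deviates. Here `ε` may be
arbitrarily small. -/
theorem risk_le_of_isVoteWinner_of_fintype [Fintype Θ] {S : Set Θ} {ε t δ : ℝ} (hε : 0 ≤ ε)
    {k m B : ℕ} {y : Fin m → Z} {v : PhaseTwo k m B} (h2 : ε + 2 * t ≤ δ) {θ θ' : Θ}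
    (hθ : IsVoteWinner l S ε y v θ) (hθ' : θ' ∈ S)
    (hdev : Fintype.card Θ *
      ∑ b, (deviating ν l t Set.univ k).indicator (fun _ => (1 : ℝ)) (fun i => y (v b i)) < B) :
    risk ν l θ ≤ risk ν l θ' + δ := by
  classical
  by_contra hbad
  set D := ∑ b, (deviating ν l t Set.univ k).indicator (fun _ => (1 : ℝ)) (fun i => y (v b i))
  have h3 : (votes l S ε y v θ : ℝ) ≤ D := by
    refine (votes_le_of_bad (y := y) (v := v) h2 hθ' (not_le.1 hbad)).trans ?_
    refine Finset.sum_le_sum fun b _ => Set.indicator_le_indicator_of_subset ?_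
      (fun _ => zero_le_one) _
    exact fun y ⟨θ, _, h⟩ => ⟨θ, Set.mem_univ θ, h⟩
  have h4 : ∀ θ'' : Θ, (votes l S ε y v θ'' : ℝ) ≤ D := by
    intro θ''
    by_cases h : θ'' ∈ S
    · exact le_trans (by exact_mod_cast hθ.2 θ'' h) h3
    · have : votes l S ε y v θ'' = 0 := by
        refine Finset.sum_eq_zero fun b _ => Set.indicator_of_notMem (fun h' => h h'.1) _
      rw [this]
      exact le_trans (by simp) h3
  have h5 := le_sum_votes l ⟨θ', hθ'⟩ hε y v
  have h6 : ∑ θ'', (votes l S ε y v θ'' : ℝ) ≤ Fintype.card Θ * D := by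
    simpa using Finset.sum_le_sum (s := Finset.univ) fun θ'' _ => h4 θ''
  linarith

end Vote

/-! ### Measurability -/

section Measurability

variable {Z Θ R : Type*} [MeasurableSpace Z] [MeasurableSpace Θ] [MeasurableSpace R]
  {ν : Measure Z} [IsProbabilityMeasure ν] {l : Θ → Z → ℝ} {A : (k : ℕ) → (Fin k → Z) → R → Θ}

theorem measurable_risk (hl : Measurable (Function.uncurry l)) : Measurable (risk ν l) :=
  (hl.stronglyMeasurable.integral_prod_right (ν := ν)).measurable

theorem measurable_empRisk (hl : Measurable (Function.uncurry l)) (k : ℕ) :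
    Measurable fun q : Θ × (Fin k → Z) => empRisk l q.2 q.1 := by
  unfold empRisk
  refine (Finset.measurable_sum _ fun i _ => ?_).const_mul _
  exact hl.comp (by fun_prop : Measurable fun q : Θ × (Fin k → Z) => (q.1, q.2 i))

theorem measurableSet_deviation (hl : Measurable (Function.uncurry l)) (k : ℕ) (t : ℝ) :
    MeasurableSet {q : Θ × (Fin k → Z) | t < |empRisk l q.2 q.1 - risk ν l q.1|} := by
  refine measurableSet_lt measurable_const ?_
  exact ((measurable_empRisk hl k).sub ((measurable_risk hl).comp measurable_fst)).abs

theorem measurable_model (hA : ∀ k, Measurable (Function.uncurry (A k))) {k m B : ℕ} (b : Fin B) :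
    Measurable fun q : (Fin m → Z) × PhaseOne R k m B =>
      A k (fun i => q.1 ((q.2 b).1 i)) (q.2 b).2 :=
  (hA k).comp ((measurable_resample_seed Z R k m).comp (by fun_prop :
    Measurable fun q : (Fin m → Z) × (Fin B → (Fin k ↪ Fin m) × R) => (q.1, q.2 b)))

theorem measurableSet_deviating_retrieved (hl : Measurable (Function.uncurry l))
    (hA : ∀ k, Measurable (Function.uncurry (A k))) (k₁ m B k₂ : ℕ) (t : ℝ) :
    MeasurableSet {q : ((Fin m → Z) × PhaseOne R k₁ m B) × (Fin k₂ → Z) |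
      q.2 ∈ deviating ν l t (retrieved A q.1.1 q.1.2) k₂} := by
  simp only [deviating, retrieved, Set.exists_range_iff, Set.mem_ofPred_eq]
  rw [Set.ofPred_exists]
  refine MeasurableSet.iUnion fun b => ?_
  exact (((measurable_model hA b).comp measurable_fst).prodMk measurable_snd)
    (measurableSet_deviation (ν := ν) hl k₂ t)

theorem measurableSet_excess (hl : Measurable (Function.uncurry l))
    (hA : ∀ k, Measurable (Function.uncurry (A k))) (k : ℕ) (c : ℝ) :
    MeasurableSet {p : (Fin k → Z) × R | c < risk ν l (A k p.1 p.2)} :=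
  measurableSet_lt measurable_const ((measurable_risk hl).comp (hA k))

theorem measurableSet_deviating_univ [Countable Θ] (hl : Measurable (Function.uncurry l))
    (k : ℕ) (t : ℝ) : MeasurableSet (deviating ν l t Set.univ k) := by
  simp only [deviating, Set.mem_univ, true_and]
  rw [Set.ofPred_exists]
  exact MeasurableSet.iUnion fun θ => measurable_prodMk_left (measurableSet_deviation hl k t)

end Measurability

/-! ### The laws of the parts of a run -/

section Run

variable {Z R Ξ : Type*} [MeasurableSpace Z] [MeasurableSpace R] [MeasurableSpace Ξ]
  (ν : Measure Z) [IsProbabilityMeasure ν] (ρ : Measure R) [IsProbabilityMeasure ρ]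
  (τ : Measure Ξ) [IsProbabilityMeasure τ]

/-- The law of the subsamples and seeds of Phase I. -/
noncomputable abbrev phaseOneLaw (k m B : ℕ) : Measure (PhaseOne R k m B) :=
  Measure.pi fun _ => (ProbabilityTheory.uniformOn (Set.univ : Set (Fin k ↪ Fin m))).prod ρ

/-- The law of the subsamples of Phase II. -/
noncomputable abbrev phaseTwoLaw (k m B : ℕ) : Measure (PhaseTwo k m B) :=
  Measure.pi fun _ => ProbabilityTheory.uniformOn (Set.univ : Set (Fin k ↪ Fin m))

theorem isProbabilityMeasure_runLaw {n k₁ m₁ B₁ k₂ m₂ B₂ : ℕ} (h₁ : k₁ ≤ m₁) (h₂ : k₂ ≤ m₂) :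
    IsProbabilityMeasure (runLaw ν ρ τ n k₁ m₁ B₁ k₂ m₂ B₂) := by
  have := nonempty_subsample h₁
  have := nonempty_subsample h₂
  unfold runLaw
  infer_instance

theorem measurePreserving_data_phaseOne {n k₁ m₁ B₁ k₂ m₂ B₂ : ℕ} (h₁ : k₁ ≤ m₁) (h₂ : k₂ ≤ m₂) :
    MeasurePreserving (fun ω : Run Z R Ξ n k₁ m₁ B₁ k₂ m₂ B₂ => (ω.1, ω.2.1))
      (runLaw ν ρ τ n k₁ m₁ B₁ k₂ m₂ B₂)
      ((Measure.pi fun _ => ν).prod (phaseOneLaw ρ k₁ m₁ B₁)) := by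
  have := nonempty_subsample h₁
  have := nonempty_subsample h₂
  exact (MeasurePreserving.id _).prod measurePreserving_fst

theorem measurePreserving_data_phaseTwo {n k₁ m₁ B₁ k₂ m₂ B₂ : ℕ} (h₁ : k₁ ≤ m₁) (h₂ : k₂ ≤ m₂) :
    MeasurePreserving (fun ω : Run Z R Ξ n k₁ m₁ B₁ k₂ m₂ B₂ => (ω.1, ω.2.2.2))
      (runLaw ν ρ τ n k₁ m₁ B₁ k₂ m₂ B₂)
      ((Measure.pi fun _ => ν).prod (phaseTwoLaw k₂ m₂ B₂)) := by
  have := nonempty_subsample h₁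
  have := nonempty_subsample h₂
  exact (MeasurePreserving.id _).prod (measurePreserving_snd.comp measurePreserving_snd)

theorem measurePreserving_prod_comm_inner {α β γ δ : Type*} [MeasurableSpace α]
    [MeasurableSpace β] [MeasurableSpace γ] [MeasurableSpace δ] (μa : Measure α) (μb : Measure β)
    (μc : Measure γ) (μd : Measure δ) [SFinite μa] [SFinite μb] [SFinite μc] [SFinite μd] :
    MeasurePreserving (fun q : (α × β) × (γ × δ) => ((q.1.1, q.2.1), (q.1.2, q.2.2)))
      ((μa.prod μb).prod (μc.prod μd)) ((μa.prod μc).prod (μb.prod μd)) := by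
  have h1 := measurePreserving_prodAssoc μa μb (μc.prod μd)
  have h2 : MeasurePreserving (fun q : β × (γ × δ) => (q.2.1, (q.1, q.2.2)))
      (μb.prod (μc.prod μd)) (μc.prod (μb.prod μd)) :=
    (measurePreserving_prodAssoc μc μb μd).comp
      (((Measure.measurePreserving_swap (μ := μb) (ν := μc)).prod (MeasurePreserving.id μd)).comp
        (measurePreserving_prodAssoc μb μc μd).symm)
  exact (measurePreserving_prodAssoc μa μc (μb.prod μd)).symm.comp
    (((MeasurePreserving.id μa).prod h2).comp h1)

theorem measurePreserving_halves (n : ℕ) :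
    MeasurePreserving (fun z : Fin n → Z => (firstHalf z, secondHalf z)) (Measure.pi fun _ => ν)
      ((Measure.pi fun _ => ν).prod (Measure.pi fun _ => ν)) := by
  let h : Fin (n / 2) ⊕ Fin (n - n / 2) → Fin n :=
    Sum.elim (fun i => ⟨i, by omega⟩) (fun i => ⟨n / 2 + i, by omega⟩)
  have hh : Function.Injective h := by
    rintro (i | i) (j | j) hij <;> simp only [h, Sum.elim_inl, Sum.elim_inr, Fin.mk.injEq] at hij
    · rw [Fin.ext hij]
    · omega
    · omega
    · rw [Fin.ext (show (i : ℕ) = j by omega)]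
  exact (measurePreserving_sumPiEquivProdPi fun _ : Fin (n / 2) ⊕ Fin (n - n / 2) => ν).comp
    (measurePreserving_comp_injective ν hh)

/-- With data splitting, the two phases are independent. -/
theorem measurePreserving_phases {n k₁ B₁ k₂ B₂ : ℕ} (h₁ : k₁ ≤ n / 2) (h₂ : k₂ ≤ n - n / 2) :
    MeasurePreserving
      (fun ω : Run Z R Ξ n k₁ (n / 2) B₁ k₂ (n - n / 2) B₂ =>
        ((firstHalf ω.1, ω.2.1), (secondHalf ω.1, ω.2.2.2)))
      (runLaw ν ρ τ n k₁ (n / 2) B₁ k₂ (n - n / 2) B₂)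
      (((Measure.pi fun _ => ν).prod (phaseOneLaw ρ k₁ (n / 2) B₁)).prod
        ((Measure.pi fun _ => ν).prod (phaseTwoLaw k₂ (n - n / 2) B₂))) := by
  have := nonempty_subsample h₁
  have := nonempty_subsample h₂
  exact (measurePreserving_prod_comm_inner _ _ _ _).comp
    ((measurePreserving_halves ν n).prod ((MeasurePreserving.id _).prod measurePreserving_snd))

end Run

theorem le_two_mul_mul_div {k m : ℕ} (hk : 1 ≤ k) (hkm : k ≤ m) : m ≤ 2 * (k * (m / k)) := by
  have h1 : 1 ≤ m / k := Nat.div_pos hkm hk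
  have h2 := Nat.div_add_mod m k
  have h3 := Nat.mod_lt m hk
  nlinarith

/-- Half of `n` observations contains at least `n / (6k)` blocks of size `k`. -/
theorem cast_le_six_mul_mul_div {k m n : ℕ} (hk : 1 ≤ k) (hkn : 2 * k ≤ n) (hm : n / 2 ≤ m) :
    (n : ℝ) ≤ 6 * (k * (m / k : ℕ)) := by
  have h1 := le_two_mul_mul_div hk (by omega : k ≤ m)
  have h2 : n ≤ 6 * (k * (m / k)) := by omega
  exact_mod_cast h2

/-! ### Finite-sample bound with data splitting -/

/-- The failure probability with data splitting is at most the sum of the tail bounds of the two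
phases; no union bound over the retrieved models is needed. -/
theorem split_tail_bound {Z Θ R Ξ : Type*} [MeasurableSpace Z] [MeasurableSpace Θ]
    [MeasurableSpace R] [MeasurableSpace Ξ]
    (ν : Measure Z) [IsProbabilityMeasure ν] (ρ : Measure R) [IsProbabilityMeasure ρ]
    (τ : Measure Ξ) [IsProbabilityMeasure τ]
    (l : Θ → Z → ℝ) (A : (k : ℕ) → (Fin k → Z) → R → Θ) {n k₁ k₂ B₁ B₂ : ℕ}
    (ε : ThresholdRule Z R Ξ k₁ (n / 2) B₁)
    (θhat : Run Z R Ξ n k₁ (n / 2) B₁ k₂ (n - n / 2) B₂ → Θ) {δ εlo εhi : ℝ}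
    (hl : Measurable (Function.uncurry l)) (hA : ∀ k, Measurable (Function.uncurry (A k)))
    (hk₁ : 1 ≤ k₁) (hk₁n : 2 * k₁ ≤ n) (hk₂ : 1 ≤ k₂) (hk₂n : 2 * k₂ ≤ n)
    (hθ : ∀ ω, IsROVEsOutput l A ε ω (θhat ω))
    (hε : ∀ᵐ ω ∂(runLaw ν ρ τ n k₁ (n / 2) B₁ k₂ (n - n / 2) B₂),
      splitThreshold ε ω ∈ Set.Icc εlo εhi)
    (hT : devTail ν l k₂ (min εlo (δ - εhi) / 2) ≤ 1 / 5) :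
    (runLaw ν ρ τ n k₁ (n / 2) B₁ k₂ (n - n / 2) B₂).real
        {ω | optRisk ν l + 2 * δ < risk ν l (θhat ω)} ≤
      min (Real.exp (-2 / 5)) (6 * devTail ν l k₂ (min εlo (δ - εhi) / 2)) ^
          ((n : ℝ) / (2 * 12 * k₂)) + Real.exp (-(B₂ : ℝ) / 100) +
        (min (Real.exp (-(1 - excessTail ν ρ l A k₁ δ) / 7)) (4 * excessTail ν ρ l A k₁ δ) ^
          ((n : ℝ) / (2 * 6 * k₁)) +
        Real.exp (-(B₁ : ℝ) * (1 - excessTail ν ρ l A k₁ δ) / 2)) := by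
  set t := min εlo (δ - εhi) / 2 with ht
  have h₁ : k₁ ≤ n / 2 := by omega
  have h₂ : k₂ ≤ n - n / 2 := by omega
  have := nonempty_subsample h₁
  have := nonempty_subsample h₂
  have := isProbabilityMeasure_runLaw ν ρ τ (n := n) (B₁ := B₁) (B₂ := B₂) h₁ h₂
  have hmp := measurePreserving_phases ν ρ τ (B₁ := B₁) (B₂ := B₂) h₁ h₂
  have hmp₁ := measurePreserving_fst.comp hmp
  set P := runLaw ν ρ τ n k₁ (n / 2) B₁ k₂ (n - n / 2) B₂
  -- all models retrieved in Phase I are bad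
  let E₁ : Set ((Fin (n / 2) → Z) × PhaseOne R k₁ (n / 2) B₁) :=
    {q | ∀ b, optRisk ν l + δ < risk ν l (A k₁ (fun i => q.1 ((q.2 b).1 i)) (q.2 b).2)}
  -- at least half of the subsamples of Phase II deviate
  let E₂ : Set (((Fin (n / 2) → Z) × PhaseOne R k₁ (n / 2) B₁) ×
      ((Fin (n - n / 2) → Z) × PhaseTwo k₂ (n - n / 2) B₂)) :=
    {q | B₂ * (1 / 2 : ℝ) ≤ ∑ b, (deviating ν l t (retrieved A q.1.1 q.1.2) k₂).indicator
      (fun _ => 1) (fun i => q.2.1 (q.2.2 b i))}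
  have hE₁ : MeasurableSet E₁ := by
    simp only [E₁]
    rw [Set.ofPred_forall]
    exact MeasurableSet.iInter fun b =>
      measurableSet_lt measurable_const ((measurable_risk hl).comp (measurable_model hA b))
  have hE₂ : MeasurableSet E₂ := by
    refine measurableSet_le measurable_const (Finset.measurable_sum _ fun b _ => ?_)
    have h3 : Measurable fun q : ((Fin (n / 2) → Z) × PhaseOne R k₁ (n / 2) B₁) ×
        ((Fin (n - n / 2) → Z) × PhaseTwo k₂ (n - n / 2) B₂) =>
        (q.1, fun i => q.2.1 (q.2.2 b i)) :=
      measurable_fst.prodMk ((measurable_resample Z k₂ (n - n / 2)).comp (by fun_prop :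
        Measurable fun q : ((Fin (n / 2) → Z) × PhaseOne R k₁ (n / 2) B₁) ×
          ((Fin (n - n / 2) → Z) × PhaseTwo k₂ (n - n / 2) B₂) => (q.2.1, q.2.2 b)))
    exact (measurable_const (a := (1 : ℝ)).indicator
      (measurableSet_deviating_retrieved (ν := ν) hl hA k₁ (n / 2) B₁ k₂ t)).comp h3
  have hP₁ : P.real ((fun ω => (firstHalf ω.1, ω.2.1)) ⁻¹' E₁) ≤
      min (Real.exp (-(1 - excessTail ν ρ l A k₁ δ) / 7)) (4 * excessTail ν ρ l A k₁ δ) ^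
          ((n : ℝ) / (2 * 6 * k₁)) +
        Real.exp (-(B₁ : ℝ) * (1 - excessTail ν ρ l A k₁ δ) / 2) := by
    refine le_of_eq_of_le (hmp₁.measureReal_preimage hE₁.nullMeasurableSet) ?_
    refine phaseOne_tail ν ρ B₁ (Nat.div_pos h₁ hk₁) (Nat.div_mul_le_self _ _)
      (measurableSet_excess hl hA k₁ (optRisk ν l + δ)) rfl (by positivity) ?_
    rw [div_le_iff₀ (by positivity)]
    linarith [cast_le_six_mul_mul_div hk₁ hk₁n le_rfl]
  have hP₂ : P.real ((fun ω => ((firstHalf ω.1, ω.2.1), (secondHalf ω.1, ω.2.2.2))) ⁻¹' E₂) ≤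
      min (Real.exp (-2 / 5)) (6 * devTail ν l k₂ t) ^ ((n : ℝ) / (2 * 12 * k₂)) +
        Real.exp (-(B₂ : ℝ) / 100) := by
    have hT0 : 0 ≤ devTail ν l k₂ t := measureReal_nonneg
    have h3 : ∀ q, ((Measure.pi fun _ => ν).prod (phaseTwoLaw k₂ (n - n / 2) B₂)).real
        (Prod.mk q ⁻¹' E₂) ≤ min (Real.exp (-2 / 5)) (6 * devTail ν l k₂ t) ^
          ((n : ℝ) / (2 * 12 * k₂)) + Real.exp (-(B₂ : ℝ) / 100) := by
      intro q
      refine phaseTwo_tail ν B₂ (Nat.div_pos h₂ hk₂) (Nat.div_mul_le_self _ _)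
        (G := deviating ν l t (retrieved A q.1 q.2) k₂) (measurable_prodMk_left
          (measurableSet_deviating_retrieved (ν := ν) hl hA k₁ (n / 2) B₁ k₂ t))
        (measureReal_deviating_le_devTail t _ k₂) hT (by positivity) ?_
      rw [div_le_iff₀ (by positivity)]
      linarith [cast_le_six_mul_mul_div hk₂ hk₂n (by omega : n / 2 ≤ n - n / 2)]
    rw [hmp.measureReal_preimage hE₂.nullMeasurableSet]
    have h4 := measureReal_prod_le_add ((Measure.pi fun _ => ν).prod (phaseOneLaw ρ k₁ (n / 2) B₁))
      _ hE₂ MeasurableSet.empty (by positivity) fun q _ => h3 q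
    rwa [measureReal_empty, zero_add] at h4
  have hP₃ : P.real {ω | splitThreshold ε ω ∉ Set.Icc εlo εhi} = 0 := by
    rw [measureReal_def, ae_iff.1 hε, ENNReal.toReal_zero]
  have hsub : {ω | optRisk ν l + 2 * δ < risk ν l (θhat ω)} ⊆
      ((fun ω => ((firstHalf ω.1, ω.2.1), (secondHalf ω.1, ω.2.2.2))) ⁻¹' E₂ ∪
        (fun ω => (firstHalf ω.1, ω.2.1)) ⁻¹' E₁) ∪
        {ω | splitThreshold ε ω ∉ Set.Icc εlo εhi} := by
    intro ω hω
    by_contra hcon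
    simp only [Set.mem_union, not_or, Set.mem_preimage, Set.mem_ofPred_eq, not_not, E₁, E₂,
      not_forall, not_le, not_lt] at hcon hω
    obtain ⟨⟨h3, b, h4⟩, h5⟩ := hcon
    have h6 := min_le_left εlo (δ - εhi)
    have h7 := min_le_right εlo (δ - εhi)
    have h8 := risk_le_of_isVoteWinner (ν := ν) (t := t) (δ := δ) (Set.finite_range _)
      (by linarith [h5.1]) (by linarith [h5.2]) (hθ ω) (Set.mem_range_self b) h3
    linarith
  refine (measureReal_mono (μ := P) hsub).trans ?_
  calc _ ≤ _ := (measureReal_union_le _ _).trans (add_le_add (measureReal_union_le _ _) hP₃.le)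
    _ ≤ _ := by rw [add_zero]; exact add_le_add hP₂ hP₁

/-! ### Consistency without data splitting -/

/-- Without data splitting, the failure probability over a finite model space is bounded by that of
three events: a large threshold, a failure of Phase I, and too many deviating subsamples. -/
theorem full_tail_bound {Z Θ R Ξ : Type*} [MeasurableSpace Z] [MeasurableSpace Θ]
    [MeasurableSpace R] [MeasurableSpace Ξ] [Fintype Θ]
    (ν : Measure Z) [IsProbabilityMeasure ν] (ρ : Measure R) [IsProbabilityMeasure ρ]
    (τ : Measure Ξ) [IsProbabilityMeasure τ]
    (l : Θ → Z → ℝ) (A : (k : ℕ) → (Fin k → Z) → R → Θ) {n k₁ k₂ B₁ B₂ : ℕ}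
    (ε : ThresholdRule Z R Ξ k₁ n B₁) (θhat : Run Z R Ξ n k₁ n B₁ k₂ n B₂ → Θ) {δ : ℝ}
    (hl : Measurable (Function.uncurry l)) (hA : ∀ k, Measurable (Function.uncurry (A k)))
    (hk₁ : 1 ≤ k₁) (hk₁n : k₁ ≤ n) (hk₂n : k₂ ≤ n) (hB₂ : 1 ≤ B₂)
    (hθ : ∀ ω, IsROVEOutput l A ε ω (θhat ω)) :
    (runLaw ν ρ τ n k₁ n B₁ k₂ n B₂).real
        {ω | optRisk ν l + 2 * δ < risk ν l (θhat ω)} ≤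
      Fintype.card Θ * devTail ν l k₂ (δ / 4) +
        (Real.exp (-(1 - excessTail ν ρ l A k₁ δ) / 7) ^ ((n : ℝ) / k₁ / 4) +
          Real.exp (-(B₁ : ℝ) * (1 - excessTail ν ρ l A k₁ δ) / 2)) +
        (runLaw ν ρ τ n k₁ n B₁ k₂ n B₂).real {ω | δ / 2 < fullThreshold ε ω} := by
  have := nonempty_subsample hk₁n
  have := nonempty_subsample hk₂n
  have := isProbabilityMeasure_runLaw ν ρ τ (n := n) (B₁ := B₁) (B₂ := B₂) hk₁n hk₂n
  have hmp₁ := measurePreserving_data_phaseOne ν ρ τ (n := n) (B₁ := B₁) (B₂ := B₂) hk₁n hk₂n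
  have hmp₂ := measurePreserving_data_phaseTwo ν ρ τ (n := n) (B₁ := B₁) (B₂ := B₂) hk₁n hk₂n
  set P := runLaw ν ρ τ n k₁ n B₁ k₂ n B₂
  -- the output of the base learner makes the model space nonempty
  have hΘ : (0 : ℝ) < Fintype.card Θ := by
    have hZ : Nonempty Z := ν.nonempty_of_neZero
    have hR : Nonempty R := ρ.nonempty_of_neZero
    have : Nonempty Θ := ⟨A 0 (fun _ => hZ.some) hR.some⟩
    exact_mod_cast Fintype.card_pos
  -- all models retrieved in Phase I are bad
  let E₁ : Set ((Fin n → Z) × PhaseOne R k₁ n B₁) :=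
    {q | ∀ b, optRisk ν l + δ < risk ν l (A k₁ (fun i => q.1 ((q.2 b).1 i)) (q.2 b).2)}
  -- too many subsamples of Phase II deviate
  let G := deviating ν l (δ / 4) Set.univ k₂
  let E₂ : Set ((Fin n → Z) × PhaseTwo k₂ n B₂) :=
    {q | (B₂ : ℝ) ≤ Fintype.card Θ * ∑ b, G.indicator (fun _ => 1) (fun i => q.1 (q.2 b i))}
  have hG : MeasurableSet G := measurableSet_deviating_univ hl k₂ (δ / 4)
  have hE₁ : MeasurableSet E₁ := by
    simp only [E₁]
    rw [Set.ofPred_forall]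
    exact MeasurableSet.iInter fun b =>
      measurableSet_lt measurable_const ((measurable_risk hl).comp (measurable_model hA b))
  have hE₂ : MeasurableSet E₂ := by
    refine measurableSet_le measurable_const
      ((Finset.measurable_sum _ fun b _ => ?_).const_mul _)
    exact (measurable_const (a := (1 : ℝ)).indicator hG).comp
      ((measurable_resample Z k₂ n).comp (by fun_prop :
        Measurable fun q : (Fin n → Z) × PhaseTwo k₂ n B₂ => (q.1, q.2 b)))
  have hP₁ : P.real ((fun ω => (ω.1, ω.2.1)) ⁻¹' E₁) ≤
      Real.exp (-(1 - excessTail ν ρ l A k₁ δ) / 7) ^ ((n : ℝ) / k₁ / 4) +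
        Real.exp (-(B₁ : ℝ) * (1 - excessTail ν ρ l A k₁ δ) / 2) := by
    rw [hmp₁.measureReal_preimage hE₁.nullMeasurableSet]
    have h3 := phaseOne_tail ν ρ B₁ (Nat.div_pos hk₁n hk₁) (Nat.div_mul_le_self _ _)
      (measurableSet_excess (ν := ν) hl hA k₁ (optRisk ν l + δ))
      (p := excessTail ν ρ l A k₁ δ) rfl
      (x := (n : ℝ) / k₁ / 4) (by positivity) (by
        have h4 : (n : ℝ) ≤ 2 * (k₁ * (n / k₁ : ℕ)) := by
          exact_mod_cast le_two_mul_mul_div hk₁ hk₁n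
        rw [div_div, div_le_iff₀ (by positivity)]
        linarith)
    refine h3.trans (add_le_add_left ?_ _)
    have hE0 : 0 ≤ excessTail ν ρ l A k₁ δ := measureReal_nonneg
    exact Real.rpow_le_rpow (le_min (Real.exp_pos _).le (by positivity)) (min_le_left _ _)
      (by positivity)
  have hP₂ : P.real ((fun ω => (ω.1, ω.2.2.2)) ⁻¹' E₂) ≤
      Fintype.card Θ * devTail ν l k₂ (δ / 4) := by
    rw [hmp₂.measureReal_preimage hE₂.nullMeasurableSet]
    refine (phaseTwo_markov ν hk₂n hB₂ hG hΘ).trans ?_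
    gcongr
    exact measureReal_deviating_le_devTail _ _ _
  have hsub : {ω | optRisk ν l + 2 * δ < risk ν l (θhat ω)} ⊆
      ((fun ω => (ω.1, ω.2.2.2)) ⁻¹' E₂ ∪ (fun ω => (ω.1, ω.2.1)) ⁻¹' E₁) ∪
        {ω | δ / 2 < fullThreshold ε ω} := by
    intro ω hω
    by_contra hcon
    simp only [Set.mem_union, not_or, Set.mem_preimage, Set.mem_ofPred_eq, E₁, E₂,
      not_forall, not_le, not_lt] at hcon hω
    obtain ⟨⟨h3, b, h4⟩, h5⟩ := hcon
    have h8 := risk_le_of_isVoteWinner_of_fintype (ν := ν) (t := δ / 4) (δ := δ)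
      (NNReal.coe_nonneg _) (by change fullThreshold ε ω + 2 * (δ / 4) ≤ δ; linarith)
      (hθ ω) (Set.mem_range_self b) h3
    linarith
  refine (measureReal_mono (μ := P) hsub).trans ?_
  calc _ ≤ _ := (measureReal_union_le _ _).trans (add_le_add_left (measureReal_union_le _ _) _)
    _ ≤ _ := add_le_add_left (add_le_add hP₂ hP₁) _

end ROVE

theorem theorem2 :
    -- with data splitting: finite-sample bound with universal constants
    (∃ C₁ C₂ C₃ C₄ C₅ C₆ C₇ : ℝ,
      0 < C₁ ∧ 0 < C₂ ∧ 0 < C₃ ∧ 0 < C₄ ∧ 0 < C₅ ∧ 0 < C₆ ∧ 0 < C₇ ∧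
      ∀ (Z : Type*) (Θ : Type*) (R : Type*) (Ξ : Type*)
        [MeasurableSpace Z] [MeasurableSpace Θ] [MeasurableSpace R] [MeasurableSpace Ξ]
        (ν : Measure Z) [IsProbabilityMeasure ν]
        (ρ : Measure R) [IsProbabilityMeasure ρ]
        (τ : Measure Ξ) [IsProbabilityMeasure τ]
        (l : Θ → Z → ℝ) (A : (k : ℕ) → (Fin k → Z) → R → Θ)
        (n k₁ k₂ B₁ B₂ : ℕ)
        (ε : ROVE.ThresholdRule Z R Ξ k₁ (n / 2) B₁)
        (θhat : ROVE.Run Z R Ξ n k₁ (n / 2) B₁ k₂ (n - n / 2) B₂ → Θ)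
        (δ εlo εhi : ℝ),
        Measurable (Function.uncurry l) →
        (∀ θ, Integrable (l θ) ν) →
        BddBelow (Set.range (ROVE.risk ν l)) →
        (∀ k, Measurable (Function.uncurry (A k))) →
        Measurable ε →
        1 ≤ k₁ → 2 * k₁ ≤ n → 1 ≤ k₂ → 2 * k₂ ≤ n → 1 ≤ B₁ → 1 ≤ B₂ →
        (∀ ω, ROVE.IsROVEsOutput l A ε ω (θhat ω)) →
        0 < δ → 0 < εlo → εlo ≤ εhi → εhi < δ →
        (∀ᵐ ω ∂(ROVE.runLaw ν ρ τ n k₁ (n / 2) B₁ k₂ (n - n / 2) B₂),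
          ROVE.splitThreshold ε ω ∈ Set.Icc εlo εhi) →
        ROVE.devTail ν l k₂ ((δ - εhi) / 2) + ROVE.devTail ν l k₂ (εlo / 2) < 1 / 5 →
        (ROVE.runLaw ν ρ τ n k₁ (n / 2) B₁ k₂ (n - n / 2) B₂).real
            {ω | ROVE.optRisk ν l + 2 * δ < ROVE.risk ν l (θhat ω)} ≤
          (B₁ : ℝ) *
              (3 * min (Real.exp (-2 / 5))
                    (C₁ * ROVE.devTail ν l k₂ (min εlo (δ - εhi) / 2)) ^
                  ((n : ℝ) / (2 * C₂ * k₂))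
                + Real.exp (-(B₂ : ℝ) / C₃))
            + min (Real.exp (-(1 - ROVE.excessTail ν ρ l A k₁ δ) / C₄))
                  (C₅ * ROVE.excessTail ν ρ l A k₁ δ) ^ ((n : ℝ) / (2 * C₆ * k₁))
            + Real.exp (-(B₁ : ℝ) * (1 - ROVE.excessTail ν ρ l A k₁ δ) / C₇)) ∧
    -- without data splitting: consistency over a finite model space
    (∀ (Z : Type*) (Θ : Type*) (R : Type*) (Ξ : ℕ → Type*)
        [MeasurableSpace Z] [MeasurableSpace Θ] [MeasurableSpace R]
        [∀ n, MeasurableSpace (Ξ n)]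
        [Finite Θ] [DiscreteMeasurableSpace Θ]
        (ν : Measure Z) [IsProbabilityMeasure ν]
        (ρ : Measure R) [IsProbabilityMeasure ρ]
        (τ : (n : ℕ) → Measure (Ξ n)) [∀ n, IsProbabilityMeasure (τ n)]
        (l : Θ → Z → ℝ) (A : (k : ℕ) → (Fin k → Z) → R → Θ)
        (k₁ k₂ B₁ B₂ : ℕ → ℕ)
        (ε : (n : ℕ) → ROVE.ThresholdRule Z R (Ξ n) (k₁ n) n (B₁ n))
        (θhat : (n : ℕ) → ROVE.Run Z R (Ξ n) n (k₁ n) n (B₁ n) (k₂ n) n (B₂ n) → Θ)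
        (δ : ℝ),
        (∀ θ, Integrable (l θ) ν) →
        (∀ θ, Measurable (l θ)) →
        (∀ k, Measurable (Function.uncurry (A k))) →
        (∀ n, Measurable (ε n)) →
        (∀ᶠ n in atTop, ∀ ω, ROVE.IsROVEOutput l A (ε n) ω (θhat n ω)) →
        (∀ t : ℝ, 0 < t → Tendsto (fun k => ROVE.devTail ν l k t) atTop (𝓝 0)) →
        0 < δ →
        limsup (fun k => ROVE.excessTail ν ρ l A k δ) atTop < 1 →
        Tendsto (fun n =>
          (ROVE.runLaw ν ρ (τ n) n (k₁ n) n (B₁ n) (k₂ n) n (B₂ n)).real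
            {ω | δ / 2 < ROVE.fullThreshold (ε n) ω}) atTop (𝓝 0) →
        Tendsto k₁ atTop atTop → Tendsto k₂ atTop atTop →
        Tendsto (fun n : ℕ => (n : ℝ) / (k₁ n : ℝ)) atTop atTop →
        Tendsto (fun n : ℕ => (n : ℝ) / (k₂ n : ℝ)) atTop atTop →
        Tendsto B₁ atTop atTop → Tendsto B₂ atTop atTop →
        Tendsto (fun n =>
          (ROVE.runLaw ν ρ (τ n) n (k₁ n) n (B₁ n) (k₂ n) n (B₂ n)).real
            {ω | ROVE.optRisk ν l + 2 * δ < ROVE.risk ν l (θhat n ω)}) atTop (𝓝 0)) := by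
  refine ⟨⟨6, 12, 100, 7, 4, 6, 2, by norm_num, by norm_num, by norm_num, by norm_num, by norm_num,
    by norm_num, by norm_num, ?_⟩, ?_⟩
  · intro Z Θ R Ξ _ _ _ _ ν _ ρ _ τ _ l A n k₁ k₂ B₁ B₂ ε θhat δ εlo εhi hl _ _ hA _ hk₁ hk₁n
      hk₂ hk₂n hB₁ _ hθ _ hεlo _ hεhi hε hT
    -- the minimum is one of the two arguments of `T`, so no monotonicity of `T` is needed
    have hT1 : 0 ≤ ROVE.devTail ν l k₂ ((δ - εhi) / 2) := measureReal_nonneg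
    have hT2 : 0 ≤ ROVE.devTail ν l k₂ (εlo / 2) := measureReal_nonneg
    have hT3 : ROVE.devTail ν l k₂ (min εlo (δ - εhi) / 2) ≤ 1 / 5 := by
      rcases min_choice εlo (δ - εhi) with h | h <;> rw [h] <;> linarith
    have hT4 : 0 ≤ ROVE.devTail ν l k₂ (min εlo (δ - εhi) / 2) := measureReal_nonneg
    refine (ROVE.split_tail_bound ν ρ τ l A ε θhat hl hA hk₁ hk₁n hk₂ hk₂n hθ hε hT3).trans ?_
    rw [add_assoc ((B₁ : ℝ) * _)]
    refine add_le_add_left ?_ _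
    set a := min (Real.exp (-2 / 5)) (6 * ROVE.devTail ν l k₂ (min εlo (δ - εhi) / 2)) ^
      ((n : ℝ) / (2 * 12 * k₂))
    have ha : 0 ≤ a := by positivity
    have hb : 0 < Real.exp (-(B₂ : ℝ) / 100) := Real.exp_pos _
    have hB : (1 : ℝ) ≤ B₁ := by exact_mod_cast hB₁
    nlinarith
  · intro Z Θ R Ξ _ _ _ _ _ _ ν _ ρ _ τ _ l A k₁ k₂ B₁ B₂ ε θhat δ _ hlm hA _ hθ hT hδ hE hε
      hk₁ hk₂ hnk₁ hnk₂ hB₁ hB₂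
    have := Fintype.ofFinite Θ
    -- a finite discrete model space makes the loss jointly measurable
    have hl : Measurable (Function.uncurry l) := measurable_from_prod_countable_right hlm
    obtain ⟨e, hEe, he1⟩ := exists_between hE
    have hEbdd : IsBoundedUnder (· ≤ ·) atTop fun k => ROVE.excessTail ν ρ l A k δ :=
      isBoundedUnder_of ⟨1, fun k => measureReal_le_one⟩
    have hEev : ∀ᶠ n in atTop, ROVE.excessTail ν ρ l A (k₁ n) δ < e :=
      hk₁.eventually (eventually_lt_of_limsup_lt hEe hEbdd)
    have hle : ∀ k : ℕ → ℕ, Tendsto k atTop atTop →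
        Tendsto (fun n : ℕ => (n : ℝ) / (k n : ℝ)) atTop atTop → ∀ᶠ n in atTop, k n ≤ n := by
      intro k hk hnk
      filter_upwards [hk.eventually_ge_atTop 1, hnk.eventually_ge_atTop 1] with n h1 h2
      rw [le_div_iff₀ (by exact_mod_cast h1), one_mul] at h2
      exact_mod_cast h2
    have hbound : Tendsto (fun n => Fintype.card Θ * ROVE.devTail ν l (k₂ n) (δ / 4) +
        (Real.exp (-(1 - e) / 7) ^ ((n : ℝ) / k₁ n / 4) +
          Real.exp (-((1 - e) / 2 * (B₁ n : ℝ)))) +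
        (ROVE.runLaw ν ρ (τ n) n (k₁ n) n (B₁ n) (k₂ n) n (B₂ n)).real
          {ω | δ / 2 < ROVE.fullThreshold (ε n) ω}) atTop (𝓝 0) := by
      have h1 : Tendsto (fun n => Fintype.card Θ * ROVE.devTail ν l (k₂ n) (δ / 4)) atTop (𝓝 0) := by
        simpa using ((hT (δ / 4) (by positivity)).comp hk₂).const_mul (Fintype.card Θ : ℝ)
      have h2 : Tendsto (fun n : ℕ => Real.exp (-(1 - e) / 7) ^ ((n : ℝ) / k₁ n / 4)) atTop
          (𝓝 0) :=
        (tendsto_rpow_atTop_of_base_lt_one _ (by linarith [Real.exp_pos (-(1 - e) / 7)])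
          (Real.exp_lt_one_iff.2 (by linarith))).comp (hnk₁.atTop_div_const (by norm_num))
      have h3 : Tendsto (fun n => Real.exp (-((1 - e) / 2 * (B₁ n : ℝ)))) atTop (𝓝 0) :=
        Real.tendsto_exp_neg_atTop_nhds_zero.comp
          ((tendsto_natCast_atTop_atTop.comp hB₁).const_mul_atTop (by linarith))
      simpa using (h1.add (h2.add h3)).add hε
    refine tendsto_of_tendsto_of_tendsto_of_le_of_le' tendsto_const_nhds hbound
      (Eventually.of_forall fun n => measureReal_nonneg) ?_
    filter_upwards [hEev, hle k₁ hk₁ hnk₁, hle k₂ hk₂ hnk₂, hk₁.eventually_ge_atTop 1,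
      hB₂.eventually_ge_atTop 1, hθ] with n h1 h2 h3 h4 h5 h6
    refine (ROVE.full_tail_bound ν ρ (τ n) l A (ε n) (θhat n) hl hA h4 h2 h3 h5 h6).trans ?_
    gcongr
    have hB0 : (0 : ℝ) ≤ B₁ n := Nat.cast_nonneg _
    nlinarith
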